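/- Let $d\ge 2$ be an integer and $0\le p\le 1/2$. Let $\mathbb T_d$ be the rooted $d$-ary tree with root $\varnothing$. **The model.** The self-similar frog model $\mathrm{SFM}(d,p)$ runs in discrete time. One frog is placed at every vertex of $\mathbb T_d$; initially the frog at $\varnothing$ is active and all others are asleep. At each time step all active frogs jump simultaneously, and a sleeping frog wakes up when its vertex is visited. All frogs follow independent non-backtracking walks: the frog from $\varnothing$ always moves to a uniformly chosen child; any other frog first moves to the parent vertex with probability $p$ and to each child with probability $(1-p)/d$; after an upward step (from a child $w$ to its parent $v$) it moves up again with probability $p/\bigl(p+(1-p)\frac{d-1}{d}\bigr)$ and otherwise to a uniformly chosen child of $v$ other than $w$; after a downward step it always moves to a uniformly chosen child. A frog that jumps to $\varnothing$ is killed there. A frog that jumps from a vertex to a child that has already been visited is killed; if several frogs jump at the same time to a child that has not been visited, exactly one of them is let in, chosen by an arbitrary fixed priority order (an enumeration) of the frogs, and the others are killed. Let $V^*\in\{0,1,2,\dots,\infty\}$ be the total number of jumps to $\varnothing$, and let $g_{d,p}(x)=\mathbb E(x^{V^*})$, where $x^\infty:=0$. **The operator.** Define polynomials, not depending on $d$ and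 $p$, by $P_1(z_1)=z_1$, $Q_2(z_1,z_2)=z_2^2$ and $$P_{k+1}(z_1,\dots,z_{k+1})=z_{k+1}^{k+1}-\sum_{l=1}^{k}\binom{k}{l-1}z_{k+1}^{k+1-l}P_l(z_1,\dots,z_l)\quad(k\ge 1),$$ $$Q_{k+1}(z_1,\dots,z_{k+1})=z_{k+1}^{k+1}-\sum_{l=2}^{k}\binom{k-1}{l-2}z_{k+1}^{k+1-l}Q_l(z_1,\dots,z_l)\quad(k\ge 2).$$ For $1\le k\le d$ let $$c^{(k-1)}_{d,p}(x)=\frac{px+(1-p)(k-1)/d}{p+(1-p)(d-1)/d},\qquad Z_k(h)=h\circ c^{(k-1)}_{d,p},$$ and let $$\mathcal A_{d,p}h(x)=\Bigl(px+\frac{1-p}{d}\Bigr)\sum_{k=1}^{d}\binom{d-1}{k-1}P_k\bigl(Z_1(h)(x),\dots,Z_k(h)(x)\bigr)+\frac{(d-1)(1-p)}{d}\sum_{k=2}^{d}\binom{d-2}{k-2}Q_k\bigl(Z_1(h)(x),\dots,Z_k(h)(x)\bigr).$$ **Claim.** $V^*$ is measurable, $g_{d,p}$ maps $[0,1)$ into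 $[0,1]$ and is nondecreasing there, and $$g_{d,p}(x)=\mathcal A_{d,p}\,g_{d,p}(x)\qquad\text{for all }x\in[0,1).$$ -/

import Mathlib

open MeasureTheory

noncomputable section

namespace FrogModel

/-! ### The tree, the non-backtracking walks and their randomness -/

/-- Vertices of the rooted `d`-ary tree: the root is `[]`, and `i :: v` is the `i`-th child of
`v`, so the parent of a non-root vertex `v` is `v.tail`. -/
abbrev Vertex (d : ℕ) : Type := List (Fin d)

/-- How a frog got to its current site: it has not moved since it was woken up, it came up from
the `j`-th child of the site, or it came down from the parent of the site. -/
inductive LastStep (d : ℕ) : Type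
  | origin : LastStep d
  | fromChild (j : Fin d) : LastStep d
  | fromParent : LastStep d
  deriving DecidableEq, Fintype

/-- A step: to the parent, or to the `i`-th child. -/
inductive Move (d : ℕ) : Type
  | up : Move d
  | down (i : Fin d) : Move d
  deriving DecidableEq, Fintype

instance (d : ℕ) : MeasurableSpace (Move d) := ⊤

/-- The vertex that a step leads to (there is no upward step from the root). -/
def Move.dest {d : ℕ} (v : Vertex d) : Move d → Vertex d
  | .up => v.tail
  | .down i => i :: v

/-- Transition probabilities of the non-backtracking walk with drift parameter `p`. The first step
is upward with probability `p`, otherwise to a uniform child. After a step up from the child `j`,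
this law is conditioned on not going back to `j`. After a step down, the walk keeps going down to
a uniform child. -/
def stepProb (d : ℕ) (p : ℝ) : LastStep d → Move d → ℝ
  | .origin, .up => p
  | .origin, .down _ => (1 - p) / d
  | .fromChild _, .up => p / (p + (1 - p) * (d - 1) / d)
  | .fromChild j, .down i => if i = j then 0 else (1 - p) / d / (p + (1 - p) * (d - 1) / d)
  | .fromParent, .up => 0
  | .fromParent, .down _ => 1 / d

/-- The law of a single step, given the previous one. -/
def stepLaw (d : ℕ) (p : ℝ) (l : LastStep d) : Measure (Move d) :=
  ∑ m : Move d, ENNReal.ofReal (stepProb d p l m) • Measure.dirac m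

/-- The step law is a probability measure. -/
theorem isProbabilityMeasure_stepLaw {d : ℕ} (hd : 2 ≤ d) {p : ℝ} (hp0 : 0 ≤ p) (hp1 : p ≤ 1)
    (l : LastStep d) : IsProbabilityMeasure (stepLaw d p l) := by
  have hd' : (2 : ℝ) ≤ d := by exact_mod_cast hd
  have hd0 : (d : ℝ) ≠ 0 := by positivity
  have hq : 0 ≤ 1 - p := by linarith
  have hD : 0 < p + (1 - p) * (d - 1) / d := by
    have h : p + (1 - p) * (d - 1) / d = ((d - 1) + p) / d := by field_simp; ring
    rw [h]
    apply div_pos <;> linarith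
  have hnn : ∀ m, 0 ≤ stepProb d p l m := by
    intro m
    rcases l with _ | j | _ <;> rcases m with _ | i <;> simp only [stepProb]
    · exact hp0
    · positivity
    · positivity
    · split_ifs
      · exact le_rfl
      · positivity
    · exact le_rfl
    · positivity
  have hsum : ∑ m : Move d, stepProb d p l m = 1 := by
    let e : Option (Fin d) ≃ Move d :=
      { toFun := fun o => o.elim .up .down
        invFun := fun m => match m with
          | .up => none
          | .down i => some i
        left_inv := by rintro (_ | i) <;> rfl
        right_inv := by rintro (_ | i) <;> rfl }
    rw [← e.sum_comp, Fintype.sum_option]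
    rcases l with _ | j | _ <;> simp only [e, Equiv.coe_fn_mk, Option.elim, stepProb]
    · simp only [Finset.sum_const, Finset.card_univ, Fintype.card_fin, nsmul_eq_mul]
      field_simp
      ring
    · have h : ∀ i : Fin d, (if i = j then (0 : ℝ) else
          (1 - p) / d / (p + (1 - p) * (d - 1) / d)) =
          (1 - p) / d / (p + (1 - p) * (d - 1) / d) -
          (if i = j then (1 - p) / d / (p + (1 - p) * (d - 1) / d) else 0) := by
        intro i; split_ifs <;> simp
      simp only [h, Finset.sum_sub_distrib, Finset.sum_const, Finset.card_univ, Fintype.card_fin,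
        nsmul_eq_mul, Finset.sum_ite_eq', Finset.mem_univ, if_true]
      rw [← mul_div_assoc, ← sub_div, ← add_div, div_eq_one_iff_eq hD.ne']
      field_simp
    · simp only [Finset.sum_const, Finset.card_univ, Fintype.card_fin, nsmul_eq_mul]
      field_simp
      ring
  constructor
  simp only [stepLaw, Measure.finsetSum_apply, Measure.smul_apply, measure_univ, smul_eq_mul,
    mul_one]
  rw [← ENNReal.ofReal_sum_of_nonneg fun m _ => hnn m, hsum, ENNReal.ofReal_one]

/-- A realization of the randomness: `ω (u, v, l)` is the step that the frog with original vertex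
`u` takes from site `v` if its last step was `l`. A non-backtracking walk never visits a site
twice, so no entry is ever used twice. -/
abbrev Env (d : ℕ) : Type := Vertex d × Vertex d × LastStep d → Move d

/-- All steps of all frogs are independent. This is a probability measure when `2 ≤ d` and
`0 ≤ p ≤ 1`, since `stepLaw` then is one. -/
def envLaw (d : ℕ) (p : ℝ) : Measure (Env d) :=
  Measure.infinitePi fun q : Vertex d × Vertex d × LastStep d => stepLaw d p q.2.2

/-! ### The self-similar frog model -/

/-- Status of a frog: asleep at its original vertex, active (with its site and last step), or
dead. -/
inductive Status (d : ℕ) : Type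
  | asleep : Status d
  | active (v : Vertex d) (l : LastStep d) : Status d
  | dead : Status d

/-- A configuration assigns a status to every frog; the frogs are named after the vertices where
they are originally placed, one per vertex. A vertex has been visited if and only if its frog is
no longer asleep. -/
abbrev Config (d : ℕ) : Type := Vertex d → Status d

/-- At the next step, the frog `u` attempts to jump to the vertex `w`. -/
def Attempts {d : ℕ} (ω : Env d) (σ : Config d) (u w : Vertex d) : Prop :=
  ∃ v l, σ u = .active v l ∧ (ω (u, v, l)).dest v = w

/-- The frog `u`, which attempts to jump down to `w`, is let in: `w` has not been visited
before (otherwise it is lethal), and `u` has priority over all frogs that attempt to jump to `w` at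
the same time. -/
def Admitted {d : ℕ} (rank : Vertex d → ℕ) (ω : Env d) (σ : Config d) (u w : Vertex d) : Prop :=
  σ w = .asleep ∧ ∀ u', Attempts ω σ u' w → rank u ≤ rank u'

open Classical in
/-- One unit of time: all active frogs jump simultaneously. A sleeping frog wakes up when its
vertex is visited. A frog that jumps to the root is killed there. A frog that jumps from
a vertex to a child is killed unless it is the one frog that is admitted to the child. -/
def step {d : ℕ} (rank : Vertex d → ℕ) (ω : Env d) (σ : Config d) : Config d := fun u =>
  match σ u with
  | .dead => .dead
  | .asleep => if ∃ u', Attempts ω σ u' u then .active u .origin else .asleep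
  | .active v l =>
    match ω (u, v, l), v with
    | .up, [] => .dead
    | .up, j :: w => if w = [] then .dead else .active w (.fromChild j)
    | .down i, v => if Admitted rank ω σ u (i :: v) then .active (i :: v) .fromParent else .dead

/-- Initially only the frog at the root is active; all its steps are to a uniform child, as if it
had come down to the root from above. -/
def initial (d : ℕ) : Config d := fun u => if u = [] then .active [] .fromParent else .asleep

/-- The self-similar frog model at time `n`. -/
def config {d : ℕ} (rank : Vertex d → ℕ) (ω : Env d) : ℕ → Config d
  | 0 => initial d
  | n + 1 => step rank ω (config rank ω n)

/-- The total number of visits (jumps) to the root, over all times and all frogs. -/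
def rootVisits {d : ℕ} (rank : Vertex d → ℕ) (ω : Env d) : ℕ∞ :=
  Set.encard {q : ℕ × Vertex d | Attempts ω (config rank ω q.1) q.2 []}

/-- `x ^ n` for `n ∈ ℕ ∪ {∞}`, where `x ^ ∞ = 0`. -/
def powENat (x : ℝ) : ℕ∞ → ℝ
  | ⊤ => 0
  | (n : ℕ) => x ^ n

/-- The probability generating function of the number of visits to the root. -/
def genFun (d : ℕ) (p : ℝ) (rank : Vertex d → ℕ) (x : ℝ) : ℝ :=
  ∫ ω, powENat x (rootVisits rank ω) ∂(envLaw d p)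

/-! ### The operator -/

/-- The polynomials `P_k` in the variables `z_1, …, z_k` (for `k ≥ 1`; the value at `0` is never
used). -/
def P : ℕ → MvPolynomial ℕ ℝ
  | 0 => 0
  | k + 1 => MvPolynomial.X (k + 1) ^ (k + 1) -
      ∑ l ∈ (Finset.Icc 1 k).attach,
        (k.choose (l.1 - 1) : MvPolynomial ℕ ℝ) * MvPolynomial.X (k + 1) ^ (k + 1 - l.1) * P l.1
  decreasing_by exact Nat.lt_succ_of_le (Finset.mem_Icc.1 l.2).2

/-- The polynomials `Q_k` in the variables `z_1, …, z_k` (for `k ≥ 2`; the values at `0` and `1` are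
never used). -/
def Q : ℕ → MvPolynomial ℕ ℝ
  | 0 => 0
  | 1 => 0
  | k + 2 => MvPolynomial.X (k + 2) ^ (k + 2) -
      ∑ l ∈ (Finset.Icc 2 (k + 1)).attach,
        (k.choose (l.1 - 2) : MvPolynomial ℕ ℝ) * MvPolynomial.X (k + 2) ^ (k + 2 - l.1) * Q l.1
  decreasing_by exact Nat.lt_succ_of_le (Finset.mem_Icc.1 l.2).2

/-- The affine functions `c^{(j)}_{d,p}`, `0 ≤ j ≤ d - 1`. -/
def c (d : ℕ) (p : ℝ) (j : ℕ) (x : ℝ) : ℝ :=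
  (p * x + (1 - p) * j / d) / (p + (1 - p) * (d - 1) / d)

/-- The composition operators `Z_k h = h ∘ c^{(k-1)}_{d,p}`, `1 ≤ k ≤ d`. -/
def Z (d : ℕ) (p : ℝ) (k : ℕ) (h : ℝ → ℝ) : ℝ → ℝ := h ∘ c d p (k - 1)

/-- The operator `𝒜_{d,p}`. -/
def A (d : ℕ) (p : ℝ) (h : ℝ → ℝ) (x : ℝ) : ℝ :=
  (p * x + (1 - p) / d) * ∑ k ∈ Finset.Icc 1 d,
      ((d - 1).choose (k - 1) : ℝ) * MvPolynomial.eval (fun i => Z d p i h x) (P k) +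
    (d - 1) * (1 - p) / d * ∑ k ∈ Finset.Icc 2 d,
      ((d - 2).choose (k - 2) : ℝ) * MvPolynomial.eval (fun i => Z d p i h x) (Q k)

end FrogModel

end

/-! The generating function is the limit of the iterates of `A d p` on the constant function 1, and
the fixed-point equation follows by continuity of `A d p`.

The first ingredient is an abelian property. The steps can be attached to places instead of frogs:
the k-th frog that leaves a site with a given last step obeys the k-th instruction of a stack kept
there. In both descriptions every active frog reads an independent entry that has never been read
before, whose law depends only on its last step. Hence the numbers of root visits up to a fixed time
have the same law (`IsFresh.integral_explore_eq`, `integral_visitsUpTo`). With stacks, the numbers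
of exits from the places evolve by a deterministic monotone map, `arrivals`, in which neither the
names nor the priorities of the frogs occur (`IsConsistent.next`, `stackState_visits`).

The increasing limit of these numbers satisfies a recursion over the tree. Two frogs act once a
non-root vertex is visited: its own and the admitted one. A visited child j sends up a number of
frogs that does not depend on when j was entered, and these frogs obey the stack reserved for
arrivals from j. So the visited children are the closure of the initially chosen ones under the
jumps, and the upward jumps add up. Cutting the recursion at depth D gives `returns`, which is
compared with the time evolution in both directions (`upExits_le_returns`, `eventually_returns_le`).

For the law, let I be the set of initially chosen children and W(S) the expectation of x to the
number of upward jumps by frogs returning from S, on the event that the closure of I is S. If h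
generates the returns of a child and z_k = `Z d p k h x`, then by independence the weight of the
event that no frog returning from S jumps to a child outside S is z_|S| ^ |S|. Sorting by the
closure S' of I inside S gives z_|S| ^ |S| = ∑ W(S') z_|S| ^ (|S| - |S'|), summed over I ⊆ S' ⊆ S.
This triangular system is the recursion for P_k when |I| = 1 and for Q_k when |I| = 2
(`prod_stayWeight`, `closureProb_eq`). Averaging over the first two steps produces `A d p`
(`isReturnGen_succ`).

In the limit, h is evaluated at the points c^{(k)}(x), which are below 1 unless p = 0. In that case
the point 1 occurs, and g(1) = 1, that is, finiteness of the number of visits, is needed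
(`genFun_one_of_eq_zero`). -/

noncomputable section

namespace FrogModel

/-! ### Functions of finitely many coordinates of a product space -/

section Cylinder

variable {ι α β γ : Type*}

/-- The function `f` depends only on finitely many coordinates, all of them in `T`. -/
def IsCylinder (f : (ι → α) → β) (T : Set ι) : Prop :=
  ∃ J : Finset ι, (J : Set ι) ⊆ T ∧ DependsOn f J

theorem IsCylinder.mono {f : (ι → α) → β} {T T' : Set ι} (hf : IsCylinder f T) (h : T ⊆ T') :
    IsCylinder f T' :=
  let ⟨J, hJ, hd⟩ := hf
  ⟨J, hJ.trans h, hd⟩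

theorem IsCylinder.dependsOn {f : (ι → α) → β} {T : Set ι} (hf : IsCylinder f T) :
    DependsOn f T :=
  let ⟨_, hJ, hd⟩ := hf
  hd.mono hJ

theorem isCylinder_const (b : β) (T : Set ι) : IsCylinder (fun _ : ι → α => b) T :=
  ⟨∅, by simp, by simp [DependsOn]⟩

theorem isCylinder_eval {T : Set ι} {i : ι} (hi : i ∈ T) :
    IsCylinder (fun ω : ι → α => ω i) T :=
  ⟨{i}, by simpa using hi, fun x y h => h i (by simp)⟩

theorem IsCylinder.comp {f : (ι → α) → β} {T : Set ι} (hf : IsCylinder f T) (g : β → γ) :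
    IsCylinder (fun ω => g (f ω)) T :=
  let ⟨J, hJ, hd⟩ := hf
  ⟨J, hJ, fun _ _ h => congrArg g (hd h)⟩

theorem isCylinder_pi {κ : Type*} [Finite κ] {B : κ → Type*} {f : ∀ k, (ι → α) → B k} {T : Set ι}
    (hf : ∀ k, IsCylinder (f k) T) : IsCylinder (fun ω k => f k ω) T := by
  classical
  have := Fintype.ofFinite κ
  choose J hJ hd using hf
  refine ⟨Finset.univ.biUnion J, by simpa using hJ, fun x y h => funext fun k => hd k fun i hi => h i ?_⟩
  simp only [Finset.coe_biUnion, Set.mem_iUnion]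
  exact ⟨k, by simp, hi⟩

theorem IsCylinder.prodMk {f : (ι → α) → β} {g : (ι → α) → γ} {T : Set ι}
    (hf : IsCylinder f T) (hg : IsCylinder g T) : IsCylinder (fun ω => (f ω, g ω)) T := by
  classical
  obtain ⟨J, hJ, hd⟩ := hf
  obtain ⟨K, hK, he⟩ := hg
  refine ⟨J ∪ K, by simp [hJ, hK], fun x y h => ?_⟩
  rw [Prod.mk.injEq]
  exact ⟨hd fun i hi => h i (by simp [Finset.mem_coe.1 hi]),
    he fun i hi => h i (by simp [Finset.mem_coe.1 hi])⟩

theorem IsCylinder.comp₂ {δ : Type*} {f : (ι → α) → β} {g : (ι → α) → γ} {T : Set ι}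
    (hf : IsCylinder f T) (hg : IsCylinder g T) (F : β → γ → δ) :
    IsCylinder (fun ω => F (f ω) (g ω)) T :=
  (hf.prodMk hg).comp fun z => F z.1 z.2

theorem isCylinder_finset_prod {κ : Type*} {s : Finset κ} {f : κ → (ι → α) → ℝ} {T : Set ι}
    (hf : ∀ k ∈ s, IsCylinder (f k) T) : IsCylinder (fun ω => ∏ k ∈ s, f k ω) T := by
  have h := (isCylinder_pi fun k : s => hf k k.2).comp fun F => ∏ k, F k
  have h' : ∀ ω, ∏ k ∈ s, f k ω = ∏ k : s, f k ω := fun ω =>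
    (Finset.prod_coe_sort s fun k => f k ω).symm
  simpa only [h'] using h

theorem isCylinder_finset_sum {κ M : Type*} [AddCommMonoid M] {s : Finset κ}
    {f : κ → (ι → α) → M} {T : Set ι}
    (hf : ∀ k ∈ s, IsCylinder (f k) T) : IsCylinder (fun ω => ∑ k ∈ s, f k ω) T := by
  have h := (isCylinder_pi fun k : s => hf k k.2).comp fun F => ∑ k, F k
  have h' : ∀ ω, ∑ k ∈ s, f k ω = ∑ k : s, f k ω := fun ω =>
    (Finset.sum_coe_sort s fun k => f k ω).symm
  simpa only [h'] using h

theorem IsCylinder.finite_range [Finite α] {f : (ι → α) → β} {T : Set ι} (hf : IsCylinder f T) :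
    (Set.range f).Finite := by
  obtain ⟨J, -, hd⟩ := hf
  rcases isEmpty_or_nonempty (ι → α) with h | ⟨⟨ω⟩⟩
  · exact Set.toFinite _
  · have : Nonempty β := ⟨f ω⟩
    obtain ⟨g, rfl⟩ := dependsOn_iff_exists_comp.1 hd
    exact (Set.finite_range g).subset (Set.range_comp_subset_range _ _)

/-- A cylinder function chosen by the value of another one is a cylinder function. -/
theorem IsCylinder.bind [Finite α] {a : (ι → α) → β} {f : β → (ι → α) → γ} {T : Set ι}
    (ha : IsCylinder a T) (hf : ∀ ω, IsCylinder (f (a ω)) T) :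
    IsCylinder (fun ω => f (a ω) ω) T := by
  classical
  have hr := ha.finite_range
  -- As `a` takes finitely many values, finitely many coordinates serve all the functions `f b` at
  -- once.
  have hf' : ∀ b : Set.range a, IsCylinder (f b) T := by
    rintro ⟨_, ω, rfl⟩
    exact hf ω
  have : Finite (Set.range a) := hr
  exact (((isCylinder_pi hf').comp₂
    (f := fun ω (b : Set.range a) => f b ω) (g := fun ω => (⟨a ω, ω, rfl⟩ : Set.range a))
    (let ⟨J, hJ, hd⟩ := ha; ⟨J, hJ, fun x y h => Subtype.ext (hd h)⟩) fun F b => F b) :)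

variable [MeasurableSpace α] [MeasurableSingletonClass α] [Finite α]

theorem IsCylinder.measurable [MeasurableSpace β] {f : (ι → α) → β} {T : Set ι}
    (hf : IsCylinder f T) : Measurable f := by
  obtain ⟨J, -, hd⟩ := hf
  rcases isEmpty_or_nonempty (ι → α) with h | ⟨⟨ω⟩⟩
  · exact measurable_of_empty f
  · have : Nonempty β := ⟨f ω⟩
    obtain ⟨g, rfl⟩ := dependsOn_iff_exists_comp.1 hd
    exact (measurable_of_finite g).comp (measurable_pi_lambda _ fun i => measurable_pi_apply _)

theorem IsCylinder.integrable {f : (ι → α) → ℝ} {T : Set ι} (hf : IsCylinder f T)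
    (P : Measure (ι → α)) [IsFiniteMeasure P] : Integrable f P := by
  obtain ⟨C, hC⟩ := (hf.finite_range.image (‖·‖)).bddAbove
  exact Integrable.of_bound hf.measurable.aestronglyMeasurable C
    (.of_forall fun ω => hC ⟨_, ⟨ω, rfl⟩, rfl⟩)

end Cylinder

/-! ### Resampling and independence in product spaces -/

section Product

variable {ι α : Type*} [MeasurableSpace α] (μ : ι → Measure α)
  [∀ i, IsProbabilityMeasure (μ i)]

open Classical in
theorem measurable_piecewise_prod (T : Set ι) :
    Measurable fun z : (ι → α) × (ι → α) => T.piecewise z.1 z.2 := by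
  refine measurable_pi_lambda _ fun i => ?_
  by_cases hi : i ∈ T
  · simp only [Set.piecewise_eq_of_mem _ _ _ hi]
    fun_prop
  · simp only [Set.piecewise_eq_of_notMem _ _ _ hi]
    fun_prop

open Classical in
/-- Resampling some coordinates does not change a product measure. -/
theorem map_piecewise_infinitePi (T : Set ι) :
    ((Measure.infinitePi μ).prod (Measure.infinitePi μ)).map
      (fun z => T.piecewise z.1 z.2) = Measure.infinitePi μ := by
  refine Measure.eq_infinitePi μ fun s t ht => ?_
  rw [Measure.map_apply (measurable_piecewise_prod T)
    (.pi s.countable_toSet fun i _ => ht i)]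
  have h : (fun z : (ι → α) × (ι → α) => T.piecewise z.1 z.2) ⁻¹' (s : Set ι).pi t =
      ((s.filter (· ∈ T) : Finset ι) : Set ι).pi t ×ˢ
        ((s.filter (· ∉ T) : Finset ι) : Set ι).pi t := by
    ext z
    simp only [Set.mem_preimage, Set.mem_pi, Set.mem_prod, Finset.coe_filter, Set.mem_ofPred_eq,
      Finset.mem_coe]
    constructor
    · intro h
      exact ⟨fun i hi => by simpa [hi.2] using h i hi.1, fun i hi => by simpa [hi.2] using h i hi.1⟩
    · rintro ⟨h1, h2⟩ i hi
      by_cases hT : i ∈ T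
      · simpa [hT] using h1 i ⟨hi, hT⟩
      · simpa [hT] using h2 i ⟨hi, hT⟩
  rw [h, Measure.prod_prod, Measure.infinitePi_pi _ fun i _ => ht i,
    Measure.infinitePi_pi _ fun i _ => ht i, Finset.prod_filter_mul_prod_filter_not]

variable [MeasurableSingletonClass α] [Finite α]

open Classical in
-- Fubini for the splitting of the coordinates into `T` and its complement. It serves as
-- conditioning on the coordinates in `T`.
theorem integral_resample {f : (ι → α) → ℝ} {T' : Set ι} (hf : IsCylinder f T') (T : Set ι) :
    ∫ ω, f ω ∂Measure.infinitePi μ =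
      ∫ ω', ∫ ω, f (T.piecewise ω' ω) ∂Measure.infinitePi μ ∂Measure.infinitePi μ := by
  conv_lhs => rw [← map_piecewise_infinitePi μ T]
  rw [integral_map (measurable_piecewise_prod T).aemeasurable
    hf.measurable.aestronglyMeasurable, integral_prod]
  obtain ⟨C, hC⟩ := (hf.finite_range.image (‖·‖)).bddAbove
  exact Integrable.of_bound
    (hf.measurable.comp (measurable_piecewise_prod T)).aestronglyMeasurable C
    (.of_forall fun ω => hC ⟨_, ⟨_, rfl⟩, rfl⟩)

theorem integral_mul_of_disjoint {f g : (ι → α) → ℝ} {T T' : Set ι} (hf : IsCylinder f T)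
    (hg : IsCylinder g T') (h : Disjoint T T') :
    ∫ ω, f ω * g ω ∂Measure.infinitePi μ =
      (∫ ω, f ω ∂Measure.infinitePi μ) * ∫ ω, g ω ∂Measure.infinitePi μ := by
  classical
  -- After resampling, `f` sees only `ω'` and `g` only `ω`, so the double integral factors.
  rw [integral_resample μ ((hf.mono Set.subset_union_left).comp₂
    (hg.mono (Set.subset_union_right (s := T))) (· * ·)) T]
  have h1 : ∀ ω' ω, f (T.piecewise ω' ω) = f ω' := fun ω' ω =>
    hf.dependsOn fun i hi => by simp [hi]
  have h2 : ∀ ω' ω, g (T.piecewise ω' ω) = g ω := fun ω' ω =>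
    hg.dependsOn fun i hi => by simp [h.notMem_of_mem_right hi]
  simp only [h1, h2, integral_const_mul, integral_mul_const]

theorem integral_prod_of_disjoint {κ : Type*} (s : Finset κ) {f : κ → (ι → α) → ℝ}
    {T : κ → Set ι} (hf : ∀ k ∈ s, IsCylinder (f k) (T k))
    (h : (s : Set κ).PairwiseDisjoint T) :
    ∫ ω, ∏ k ∈ s, f k ω ∂Measure.infinitePi μ =
      ∏ k ∈ s, ∫ ω, f k ω ∂Measure.infinitePi μ := by
  classical
  induction s using Finset.induction_on with
  | empty => simp
  | insert a s ha ih =>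
    simp only [Finset.prod_insert ha]
    rw [integral_mul_of_disjoint μ (hf a (by simp))
      (isCylinder_finset_prod (T := ⋃ k ∈ s, T k) fun k hk => (hf k (by simp [hk])).mono
        (Set.subset_biUnion_of_mem (u := T) hk)),
      ih (fun k hk => hf k (by simp [hk])) (h.subset (by simp))]
    rw [Set.disjoint_iUnion₂_right]
    exact fun k hk => h (by simp) (by simp [hk]) (by rintro rfl; exact ha hk)

theorem integral_eval (i : ι) (f : α → ℝ) :
    ∫ ω, f (ω i) ∂Measure.infinitePi μ = ∫ a, f a ∂μ i := by
  rw [← Measure.infinitePi_map_eval μ i, integral_map (measurable_pi_apply i).aemeasurable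
    (measurable_of_finite f).aestronglyMeasurable]

/-- The coordinates that are read off at distinct places of a product space are independent. -/
theorem integral_comp_injOn {κ : Type*} {A : Finset κ} {q : κ → ι} (hq : Set.InjOn q A)
    (ν : κ → Measure α) [∀ k, IsProbabilityMeasure (ν k)] (hν : ∀ k ∈ A, μ (q k) = ν k)
    {f : (κ → α) → ℝ} (hf : DependsOn f A) :
    ∫ ω, f (fun k => ω (q k)) ∂Measure.infinitePi μ = ∫ m, f m ∂Measure.infinitePi ν := by
  classical
  have h1 : (Measure.infinitePi μ).map (fun ω (k : A) => ω (q k)) =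
      Measure.infinitePi fun k : A => ν k := by
    refine Measure.eq_infinitePi _ fun s t ht => ?_
    have hm : Measurable fun (ω : ι → α) (k : A) => ω (q k) :=
      measurable_pi_lambda _ fun k => measurable_pi_apply _
    rw [Measure.map_apply hm (.pi s.countable_toSet fun i _ => ht i)]
    have hinj : Function.Injective fun k : A => q k := fun a b hab =>
      Subtype.ext (hq a.2 b.2 hab)
    -- The preimage of a box is a box: by injectivity, the constraint on coordinate `i` comes from
    -- the only `k` with `q k = i`.
    have h : (fun (ω : ι → α) (k : A) => ω (q k)) ⁻¹' (s : Set A).pi t =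
        ((s.image fun k : A => q k : Finset ι) : Set ι).pi
          (fun i => if h : ∃ k : A, q k = i then t h.choose else Set.univ) := by
      ext ω
      simp only [Set.mem_preimage, Set.mem_pi, Finset.coe_image, Set.mem_image, Finset.mem_coe,
        forall_exists_index, and_imp, forall_apply_eq_imp_iff₂]
      refine forall₂_congr fun k hk => ?_
      have hex : ∃ k' : A, q k' = q k := ⟨k, rfl⟩
      rw [dif_pos hex, hinj hex.choose_spec]
    rw [h, Measure.infinitePi_pi, Finset.prod_image hinj.injOn]
    · refine Finset.prod_congr rfl fun k hk => ?_
      have hex : ∃ k' : A, q k' = q k := ⟨k, rfl⟩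
      rw [dif_pos hex, hinj hex.choose_spec, hν k k.2]
    · exact fun i _ => Set.toFinite _ |>.measurableSet
  have h2 := Measure.infinitePi_map_restrict' ν (I := (A : Set κ))
  rcases isEmpty_or_nonempty (κ → α) with hne | ⟨⟨m₀⟩⟩
  · have : Measure.infinitePi ν Set.univ = 0 := by simp [Set.eq_empty_of_isEmpty]
    simp at this
  have : Nonempty ℝ := ⟨0⟩
  obtain ⟨g, rfl⟩ := dependsOn_iff_exists_comp.1 hf
  have hg : Measurable g := measurable_of_finite g
  calc _ = ∫ ω, g (fun k : A => ω (q k)) ∂Measure.infinitePi μ := rfl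
    _ = ∫ m, g m ∂Measure.infinitePi fun k : A => ν k := by
      have := integral_map (μ := Measure.infinitePi μ) (φ := fun ω (k : A) => ω (q k))
        (Measurable.aemeasurable <| measurable_pi_lambda _ fun k => measurable_pi_apply _)
        (f := g) hg.aestronglyMeasurable
      rw [h1] at this
      exact this.symm
    _ = _ := by
      have := integral_map (μ := Measure.infinitePi ν) (φ := (A : Set κ).domRestrict)
        (by fun_prop) (f := g) hg.aestronglyMeasurable
      rw [h2] at this
      exact this

end Product

/-! ### Adaptive exploration of a product space -/

section Exploration

variable {ι α S U : Type*}

/-- One step of an exploration: in the state `s`, the agent `u` reads the coordinate `read s u`. -/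
def explore (read : S → U → ι) (next : S → (U → α) → S) (ω : ι → α) (s : S) : S :=
  next s fun u => ω (read s u)

/-- An exploration in which, in each state `s`, the agents in the finite set `act s` read distinct
coordinates, all of which lie in the set `rem s` and are never read again. -/
structure IsFresh (read : S → U → ι) (next : S → (U → α) → S) (good : S → Prop)
    (act : S → Finset U) (rem : S → Set ι) : Prop where
  good_next : ∀ s m, good s → good (next s m)
  next_dependsOn : ∀ s, good s → DependsOn (next s) (act s)
  read_mem : ∀ s, good s → ∀ u ∈ act s, read s u ∈ rem s
  read_inj : ∀ s, good s → Set.InjOn (read s) (act s)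
  rem_next : ∀ s m, good s → rem (next s m) ⊆ rem s \ read s '' act s

variable {read : S → U → ι} {next : S → (U → α) → S} {good : S → Prop}
  {act : S → Finset U} {rem : S → Set ι}

/-- Each step reads finitely many coordinates and has finitely many outcomes, so n steps involve
finitely many coordinates. Freshness is not needed; with `rem` equal to the whole index set this
gives measurability. -/
theorem isCylinder_explore [Finite α] (good_next : ∀ s m, good s → good (next s m))
    (next_dependsOn : ∀ s, good s → DependsOn (next s) (act s))
    (read_mem : ∀ s, good s → ∀ u ∈ act s, read s u ∈ rem s)
    (rem_next : ∀ s m, good s → rem (next s m) ⊆ rem s) (n : ℕ) :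
    ∀ s, good s → IsCylinder (fun ω => (explore read next ω)^[n] s) (rem s) := by
  classical
  induction n with
  | zero => exact fun s _ => isCylinder_const s _
  | succ n ih =>
    intro s hs
    simp only [Function.iterate_succ_apply]
    refine IsCylinder.bind (a := fun ω => explore read next ω s)
      (f := fun s' ω => (explore read next ω)^[n] s') ?_ fun ω => ?_
    · refine ⟨(act s).image (read s), ?_, fun x y hxy => next_dependsOn s hs fun u hu => ?_⟩
      · intro i hi
        obtain ⟨u, hu, rfl⟩ := Finset.mem_image.1 hi
        exact read_mem s hs u hu
      · exact hxy _ (by simpa using ⟨u, hu, rfl⟩)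
    · exact (ih _ (good_next _ _ hs)).mono (rem_next _ _ hs)

theorem IsFresh.isCylinder_explore [Finite α] (h : IsFresh read next good act rem) (n : ℕ) :
    ∀ s, good s → IsCylinder (fun ω => (explore read next ω)^[n] s) (rem s) :=
  FrogModel.isCylinder_explore h.good_next h.next_dependsOn h.read_mem
    (fun s m hs => (h.rem_next s m hs).trans Set.sdiff_subset) n

variable [MeasurableSpace α] [MeasurableSingletonClass α] [Finite α] (μ : ι → Measure α)
  [∀ i, IsProbabilityMeasure (μ i)]

/-- The Markov property of a fresh exploration. -/
theorem IsFresh.integral_explore_succ (h : IsFresh read next good act rem) (n : ℕ) {s : S}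
    (hs : good s) (ν : U → Measure α) [∀ u, IsProbabilityMeasure (ν u)]
    (hν : ∀ u ∈ act s, μ (read s u) = ν u) (φ : S → ℝ) :
    ∫ ω, φ ((explore read next ω)^[n + 1] s) ∂Measure.infinitePi μ =
      ∫ m, ∫ ω, φ ((explore read next ω)^[n] (next s m)) ∂Measure.infinitePi μ
        ∂Measure.infinitePi ν := by
  classical
  -- The first step reads exactly `read s '' act s`; these coordinates are taken from `ω'` and all
  -- others from `ω`.
  rw [integral_resample μ ((h.isCylinder_explore (n + 1) s hs).comp φ) (read s '' act s),
    ← integral_comp_injOn μ (h.read_inj s hs) ν hν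
      (f := fun m => ∫ ω, φ ((explore read next ω)^[n] (next s m)) ∂Measure.infinitePi μ)
      fun m m' hm => by simp only [h.next_dependsOn s hs hm]]
  congr! 4 with ω' ω
  rw [Function.iterate_succ_apply]
  have h1 : ∀ ω, explore read next ((read s '' act s).piecewise ω' ω) s =
      next s fun u => ω' (read s u) := fun ω =>
    h.next_dependsOn s hs fun u hu => by
      simp [Set.mem_image_of_mem (read s) (Finset.mem_coe.2 hu)]
  rw [h1]
  -- The later steps only read coordinates in `rem` of the new state, which avoids those already
  -- used.
  refine congrArg φ ((h.isCylinder_explore n _ (h.good_next _ _ hs)).dependsOn fun i hi => by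
    simp [(h.rem_next _ _ hs hi).2])

/-- Two fresh explorations with the same transitions have the same law. -/
theorem IsFresh.integral_explore_eq {ι' S' : Type*} {read' : S' → U → ι'}
    {next' : S' → (U → α) → S'} {good' : S' → Prop} {act' : S' → Finset U} {rem' : S' → Set ι'}
    (h : IsFresh read next good act rem) (h' : IsFresh read' next' good' act' rem')
    (μ' : ι' → Measure α) [∀ i, IsProbabilityMeasure (μ' i)] (π : S' → S)
    (hgood : ∀ s, good' s → good (π s)) (hnext : ∀ s m, π (next' s m) = next (π s) m)
    (ν : S → U → Measure α) [∀ s u, IsProbabilityMeasure (ν s u)]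
    (hν : ∀ s, good s → ∀ u ∈ act s, μ (read s u) = ν s u)
    (hν' : ∀ s, good' s → ∀ u ∈ act' s, μ' (read' s u) = ν (π s) u) (φ : S → ℝ) (n : ℕ) :
    ∀ s, good' s → ∫ ω, φ ((explore read next ω)^[n] (π s)) ∂Measure.infinitePi μ =
      ∫ ω, φ (π ((explore read' next' ω)^[n] s)) ∂Measure.infinitePi μ' := by
  induction n with
  | zero => simp
  | succ n ih =>
    intro s hs
    rw [h.integral_explore_succ μ n (hgood s hs) (ν (π s)) (hν _ (hgood s hs)),
      h'.integral_explore_succ μ' n hs (ν (π s)) (hν' s hs) fun s => φ (π s)]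
    congr! 2 with m
    rw [← hnext, ih _ (h'.good_next _ _ hs)]

end Exploration

section

variable {d : ℕ}

/-! ### One step of the frog model -/

/-- The place of a frog: its site and its last step. -/
abbrev Place (d : ℕ) : Type := Vertex d × LastStep d

/-- The place of an active frog (with an arbitrary value for the other frogs). -/
def Status.place : Status d → Place d
  | .active v l => (v, l)
  | _ => ([], .origin)

/-- The set of active frogs. -/
def actives (σ : Config d) : Set (Vertex d) := {u | ∃ v l, σ u = .active v l}

/-- The set of active frogs at a given place. -/
def activesAt (σ : Config d) (x : Place d) : Set (Vertex d) := {u | σ u = .active x.1 x.2}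

theorem activesAt_subset (σ : Config d) (x : Place d) : activesAt σ x ⊆ actives σ :=
  fun _ hu => ⟨_, _, hu⟩

/-- The frogs that jump to the root at the next step. -/
def jumpers (ω : Env d) (σ : Config d) : Set (Vertex d) := {u | Attempts ω σ u []}

theorem attempts_congr {ω ω' : Env d} {σ : Config d}
    (h : ∀ u v l, σ u = .active v l → ω (u, v, l) = ω' (u, v, l)) (u w : Vertex d) :
    Attempts ω σ u w ↔ Attempts ω' σ u w := by
  refine exists₂_congr fun v l => and_congr_right fun hu => ?_
  rw [h u v l hu]

theorem jumpers_congr {ω ω' : Env d} {σ : Config d}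
    (h : ∀ u v l, σ u = .active v l → ω (u, v, l) = ω' (u, v, l)) :
    jumpers ω σ = jumpers ω' σ :=
  Set.ext fun u => attempts_congr h u []

theorem admitted_congr {rank : Vertex d → ℕ} {ω ω' : Env d} {σ : Config d}
    (h : ∀ u v l, σ u = .active v l → ω (u, v, l) = ω' (u, v, l)) (u w : Vertex d) :
    Admitted rank ω σ u w ↔ Admitted rank ω' σ u w := by
  simp only [Admitted, attempts_congr h]

theorem step_of_asleep {rank : Vertex d → ℕ} {ω : Env d} {σ : Config d} {u : Vertex d}
    (hu : σ u = .asleep) [Decidable (∃ u', Attempts ω σ u' u)] :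
    step rank ω σ u = if ∃ u', Attempts ω σ u' u then .active u .origin else .asleep := by
  simp only [step, hu]
  congr

theorem step_of_dead {rank : Vertex d → ℕ} {ω : Env d} {σ : Config d} {u : Vertex d}
    (hu : σ u = .dead) : step rank ω σ u = .dead := by
  simp only [step, hu]

theorem step_of_up_nil {rank : Vertex d → ℕ} {ω : Env d} {σ : Config d} {u : Vertex d}
    {l : LastStep d} (hu : σ u = .active [] l) (hm : ω (u, [], l) = .up) :
    step rank ω σ u = .dead := by
  simp only [step, hu, hm]

theorem step_of_up_cons {rank : Vertex d → ℕ} {ω : Env d} {σ : Config d} {u w : Vertex d}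
    {j : Fin d} {l : LastStep d} (hu : σ u = .active (j :: w) l) (hm : ω (u, j :: w, l) = .up) :
    step rank ω σ u = if w = [] then .dead else .active w (.fromChild j) := by
  simp only [step, hu, hm]

theorem step_of_down {rank : Vertex d → ℕ} {ω : Env d} {σ : Config d} {u v : Vertex d}
    {i : Fin d} {l : LastStep d} (hu : σ u = .active v l) (hm : ω (u, v, l) = .down i)
    [Decidable (Admitted rank ω σ u (i :: v))] :
    step rank ω σ u =
      if Admitted rank ω σ u (i :: v) then .active (i :: v) .fromParent else .dead := by
  simp only [step, hu, hm]
  congr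

theorem step_congr {rank : Vertex d → ℕ} {ω ω' : Env d} {σ : Config d}
    (h : ∀ u v l, σ u = .active v l → ω (u, v, l) = ω' (u, v, l)) :
    step rank ω σ = step rank ω' σ := by
  classical
  funext u
  rcases hu : σ u with _ | ⟨v, l⟩ | _
  · simp only [step_of_asleep hu, attempts_congr h]
  · rcases hm : ω (u, v, l) with _ | i
    · rcases v with _ | ⟨j, w⟩
      · rw [step_of_up_nil hu hm, step_of_up_nil hu (h u _ _ hu ▸ hm)]
      · rw [step_of_up_cons hu hm, step_of_up_cons hu (h u _ _ hu ▸ hm)]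
    · simp only [step_of_down hu hm, step_of_down hu (h u _ _ hu ▸ hm), admitted_congr h]
  · rw [step_of_dead hu, step_of_dead hu]

theorem step_asleep_iff {rank : Vertex d → ℕ} {ω : Env d} {σ : Config d} {u : Vertex d} :
    step rank ω σ u = .asleep ↔ σ u = .asleep ∧ ¬ ∃ u', Attempts ω σ u' u := by
  classical
  rcases hu : σ u with _ | ⟨v, l⟩ | _
  · rw [step_of_asleep hu]
    split_ifs with h <;> simp [h]
  · rcases hm : ω (u, v, l) with _ | i
    · rcases v with _ | ⟨j, w⟩
      · simp [step_of_up_nil hu hm]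
      · rw [step_of_up_cons hu hm]
        split_ifs <;> simp
    · rw [step_of_down hu hm]
      split_ifs <;> simp
  · simp [step_of_dead hu]

/-- How a frog can become or stay active. -/
theorem step_eq_active_iff {rank : Vertex d → ℕ} {ω : Env d} {σ : Config d} {u v : Vertex d}
    {l : LastStep d} : step rank ω σ u = .active v l ↔
      (σ u = .asleep ∧ (∃ u', Attempts ω σ u' u) ∧ v = u ∧ l = .origin) ∨
      (∃ j l', σ u = .active (j :: v) l' ∧ ω (u, j :: v, l') = .up ∧ v ≠ [] ∧ l = .fromChild j) ∨
      (∃ i v' l', σ u = .active v' l' ∧ ω (u, v', l') = .down i ∧ Admitted rank ω σ u (i :: v') ∧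
        v = i :: v' ∧ l = .fromParent) := by
  classical
  constructor
  · intro h
    rcases hu : σ u with _ | ⟨v', l'⟩ | _
    · rw [step_of_asleep hu] at h
      split_ifs at h with ha
      cases h
      exact .inl ⟨rfl, ha, rfl, rfl⟩
    · rcases hm : ω (u, v', l') with _ | i
      · rcases v' with _ | ⟨j, w⟩
        · simp [step_of_up_nil hu hm] at h
        · rw [step_of_up_cons hu hm] at h
          split_ifs at h with hw
          cases h
          exact .inr <| .inl ⟨j, l', rfl, hm, hw, rfl⟩
      · rw [step_of_down hu hm] at h
        split_ifs at h with ha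
        cases h
        exact .inr <| .inr ⟨i, v', l', rfl, hm, ha, rfl, rfl⟩
    · simp [step_of_dead hu] at h
  · rintro (⟨hu, h, rfl, rfl⟩ | ⟨j, l', hu, hm, hv, rfl⟩ | ⟨i, v', l', hu, hm, ha, rfl, rfl⟩)
    · rw [step_of_asleep hu, if_pos h]
    · rw [step_of_up_cons hu hm, if_neg hv]
    · rw [step_of_down hu hm, if_pos ha]

/-- The vertex that an active frog attempts to jump to. -/
theorem Attempts.eq_dest {ω : Env d} {σ : Config d} {u w : Vertex d} (h : Attempts ω σ u w) :
    w = (ω (u, (σ u).place)).dest (σ u).place.1 := by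
  obtain ⟨v, l, hu, rfl⟩ := h
  simp [hu, Status.place]

theorem Attempts.mem_actives {ω : Env d} {σ : Config d} {u w : Vertex d}
    (h : Attempts ω σ u w) : u ∈ actives σ :=
  let ⟨v, l, hu, _⟩ := h
  ⟨v, l, hu⟩

/-- A frog that has just been woken is named after the destination of some active frog, so there are
at most as many new frogs as old ones. -/
theorem finite_actives_step {rank : Vertex d → ℕ} {ω : Env d} {σ : Config d}
    (h : (actives σ).Finite) : (actives (step rank ω σ)).Finite := by
  refine (h.union (h.image fun u => (ω (u, (σ u).place)).dest (σ u).place.1)).subset ?_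
  rintro u ⟨v, l, hu⟩
  rcases step_eq_active_iff.1 hu with ⟨-, ⟨u', h'⟩, -⟩ | ⟨j, l', hu', -⟩ | ⟨i, v', l', hu', -⟩
  · exact .inr ⟨u', h'.mem_actives, h'.eq_dest.symm⟩
  · exact .inl ⟨_, _, hu'⟩
  · exact .inl ⟨_, _, hu'⟩

/-! ### The frog model as a fresh exploration -/

/-- A configuration together with the number of jumps to the root so far. -/
abbrev State (d : ℕ) : Type := Config d × ℕ

/-- The next state, given the moves of the active frogs. -/
def nextState (rank : Vertex d → ℕ) (s : State d) (m : Vertex d → Move d) : State d :=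
  (step rank (fun q => m q.1) s.1, s.2 + (jumpers (fun q => m q.1) s.1).ncard)

theorem nextState_congr {rank : Vertex d → ℕ} {s : State d} {m : Vertex d → Move d} {ω : Env d}
    (h : ∀ u v l, s.1 u = .active v l → m u = ω (u, v, l)) :
    nextState rank s m = (step rank ω s.1, s.2 + (jumpers ω s.1).ncard) := by
  rw [nextState, step_congr h, jumpers_congr h]

open Classical in
/-- The active frogs as a finite set. -/
def activeFinset (σ : Config d) : Finset (Vertex d) :=
  if h : (actives σ).Finite then h.toFinset else ∅

theorem coe_activeFinset {σ : Config d} (h : (actives σ).Finite) :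
    (activeFinset σ : Set (Vertex d)) = actives σ := by
  simp [activeFinset, h]

theorem mem_activeFinset {σ : Config d} (h : (actives σ).Finite) {u : Vertex d} :
    u ∈ activeFinset σ ↔ u ∈ actives σ := by
  rw [← coe_activeFinset h, Finset.mem_coe]

theorem nextState_dependsOn {rank : Vertex d → ℕ} {s : State d} (h : (actives s.1).Finite) :
    DependsOn (nextState rank s) (activeFinset s.1) := by
  intro m m' hm
  rw [coe_activeFinset h] at hm
  exact nextState_congr fun u v l hu => hm u ⟨v, l, hu⟩

/-- The entry of the environment that a frog reads. -/
def readEnv (s : State d) (u : Vertex d) : Vertex d × Vertex d × LastStep d := (u, (s.1 u).place)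

/-- This quantity increases along a non-backtracking walk. -/
def progress : Place d → ℤ
  | (v, .fromParent) => v.length + 1
  | (v, _) => -v.length

/-- The entries of the environment that can be read later. -/
def remEnv (s : State d) : Set (Vertex d × Vertex d × LastStep d) :=
  {q | s.1 q.1 = .asleep ∨ ∃ v l, s.1 q.1 = .active v l ∧ progress (v, l) ≤ progress q.2}

/-- After a downward step an upward one would lower `progress`. Such a step has probability zero,
but it must be excluded surely for freshness to hold, which is what `fixMove` does. -/
theorem progress_up_lt (v : Vertex d) (j : Fin d) (l : LastStep d) (hl : l ≠ .fromParent) :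
    progress (j :: v, l) < progress (v, .fromChild j) := by
  rcases l with _ | _ | _ <;> simp [progress] at hl ⊢

theorem progress_down_lt (v : Vertex d) (i : Fin d) (l : LastStep d) :
    progress (v, l) < progress (i :: v, .fromParent) := by
  rcases l with _ | _ | _ <;> simp [progress] <;> omega

/-- Replace the impossible upward step after a downward step by a downward step. -/
def fixMove (i₀ : Fin d) : LastStep d → Move d → Move d
  | .fromParent, .up => .down i₀
  | _, m => m

theorem fixMove_fromParent_ne_up (i₀ : Fin d) (m : Move d) : fixMove i₀ .fromParent m ≠ .up := by
  rcases m with _ | i <;> simp [fixMove]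

/-- The next state when impossible moves are replaced. -/
def nextFixed (rank : Vertex d → ℕ) (i₀ : Fin d) (s : State d) (m : Vertex d → Move d) : State d :=
  nextState rank s fun u => fixMove i₀ (s.1 u).place.2 (m u)

theorem nextFixed_dependsOn {rank : Vertex d → ℕ} {i₀ : Fin d} {s : State d}
    (h : (actives s.1).Finite) : DependsOn (nextFixed rank i₀ s) (activeFinset s.1) :=
  fun _ _ hm => nextState_dependsOn h fun u hu => congrArg _ (hm u hu)

/-- Entries read by different frogs differ in the name of the frog, and one frog never reads an
entry twice because its `progress` strictly increases. -/
theorem isFresh_env (rank : Vertex d → ℕ) (i₀ : Fin d) :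
    IsFresh readEnv (nextFixed rank i₀) (fun s => (actives s.1).Finite)
      (fun s => activeFinset s.1) remEnv where
  good_next s m h := finite_actives_step h
  next_dependsOn s h := nextFixed_dependsOn h
  read_mem s h u hu := by
    obtain ⟨v, l, hu⟩ := (mem_activeFinset h).1 hu
    exact .inr ⟨v, l, hu, by simp [readEnv, hu, Status.place]⟩
  read_inj s h u hu u' hu' huu' := congrArg Prod.fst huu'
  rem_next s m h := by
    rintro ⟨u, x⟩ hq
    rcases hq with hq | ⟨v, l, hq, hx⟩
    · have hq : s.1 u = .asleep := (step_asleep_iff.1 hq).1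
      refine ⟨.inl hq, ?_⟩
      rintro ⟨u', hu', he⟩
      obtain ⟨v, l, hu'⟩ := (mem_activeFinset h).1 hu'
      obtain rfl : u' = u := congrArg Prod.fst he
      simp [hq] at hu'
    · have key : ∀ v' l', s.1 u = .active v' l' → progress (v', l') < progress (v, l) →
          (u, x) ∈ remEnv s \ readEnv s '' activeFinset s.1 := by
        intro v' l' hu hlt
        refine ⟨.inr ⟨v', l', hu, hlt.le.trans hx⟩, ?_⟩
        rintro ⟨u', hu', he⟩
        obtain rfl : u' = u := congrArg Prod.fst he
        have : (v', l') = x := by simpa [readEnv, hu, Status.place] using he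
        subst this
        exact absurd hlt (not_lt.2 hx)
      rcases step_eq_active_iff.1 hq with ⟨hu, -⟩ | ⟨j, l', hu, hm, hv, rfl⟩ |
        ⟨i, v', l', hu, hm, ha, rfl, rfl⟩
      · refine ⟨.inl hu, ?_⟩
        rintro ⟨u', hu', he⟩
        obtain ⟨v, l, hu'⟩ := (mem_activeFinset h).1 hu'
        obtain rfl : u' = u := congrArg Prod.fst he
        simp [hu] at hu'
      · refine key _ _ hu (progress_up_lt v j l' ?_)
        rintro rfl
        simp only [hu, Status.place] at hm
        exact fixMove_fromParent_ne_up _ _ hm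
      · exact key _ _ hu (progress_down_lt v' i l')

/-! ### The frog model driven by stacks of instructions -/

/-- Stacks of instructions: `ξ (x, k)` is the step of the `k`-th frog that leaves the place `x`. -/
abbrev Stack (d : ℕ) : Type := Place d × ℕ → Move d

/-- The number of frogs that have left each place so far. -/
abbrev Odometer (d : ℕ) : Type := Place d → ℕ

/-- The number of active frogs at the same place with higher priority. -/
def position (rank : Vertex d → ℕ) (σ : Config d) (u : Vertex d) : ℕ :=
  {u' ∈ activesAt σ (σ u).place | rank u' < rank u}.ncard

/-- The stack entry that a frog reads. -/
def readStack (rank : Vertex d → ℕ) (s : State d × Odometer d) (u : Vertex d) : Place d × ℕ :=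
  ((s.1.1 u).place, s.2 (s.1.1 u).place + position rank s.1.1 u)

/-- The next odometer: all active frogs leave their places. -/
def nextOdometer (σ : Config d) (O : Odometer d) : Odometer d :=
  fun x => O x + (activesAt σ x).ncard

/-- The next state and odometer, given the moves of the active frogs. -/
def nextStack (rank : Vertex d → ℕ) (i₀ : Fin d) (s : State d × Odometer d)
    (m : Vertex d → Move d) : State d × Odometer d :=
  (nextFixed rank i₀ s.1 m, nextOdometer s.1.1 s.2)

/-- The stack entries that have not been used. -/
def remStack (s : State d × Odometer d) : Set (Place d × ℕ) := {q | s.2 q.1 ≤ q.2}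

/-- Applied to the active frogs at one place, this makes them read the next unused entries of its
stack in order of priority, each entry once and without gaps. -/
theorem bijOn_ncard_lt {U : Type*} {rank : U → ℕ} (hrank : Function.Injective rank) {A : Set U}
    (hA : A.Finite) :
    Set.BijOn (fun u => {u' ∈ A | rank u' < rank u}.ncard) A (Set.Iio A.ncard) := by
  have hmaps : Set.MapsTo (fun u => {u' ∈ A | rank u' < rank u}.ncard) A (Set.Iio A.ncard) :=
    fun u hu => Set.ncard_lt_ncard
      ⟨fun u' h => h.1, fun h => lt_irrefl _ (h hu).2⟩ hA
  have hlt : ∀ u ∈ A, ∀ u' ∈ A, rank u < rank u' →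
      {u'' ∈ A | rank u'' < rank u}.ncard < {u'' ∈ A | rank u'' < rank u'}.ncard :=
    fun u hu u' hu' h => Set.ncard_lt_ncard
      ⟨fun u'' h'' => ⟨h''.1, h''.2.trans h⟩, fun h' => lt_irrefl _ (h' ⟨hu, h⟩).2⟩
      (hA.subset fun _ h => h.1)
  have hinj : Set.InjOn (fun u => {u' ∈ A | rank u' < rank u}.ncard) A := by
    intro u hu u' hu' h
    rcases lt_trichotomy (rank u) (rank u') with h' | h' | h'
    · exact absurd h (hlt u hu u' hu' h').ne
    · exact hrank h'
    · exact absurd h (hlt u' hu' u hu h').ne'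
  refine ⟨hmaps, hinj, ?_⟩
  have := Set.eq_of_subset_of_ncard_le hmaps.image_subset
    (by rw [hinj.ncard_image]; simp [Set.ncard_eq_toFinset_card']) (Set.finite_Iio _)
  exact this.ge

theorem bijOn_position {rank : Vertex d → ℕ} (hrank : Function.Injective rank) {σ : Config d}
    (h : (actives σ).Finite) (x : Place d) :
    Set.BijOn (position rank σ) (activesAt σ x) (Set.Iio (activesAt σ x).ncard) :=
  (bijOn_ncard_lt hrank (h.subset (activesAt_subset σ x))).congr fun u hu => by
    have : (σ u).place = x := by rw [show σ u = _ from hu]; rfl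
    simp only [position, this]

/-- Frogs at different places read different stacks and frogs at one place read consecutive entries;
the odometer then moves past all of these. -/
theorem isFresh_stack {rank : Vertex d → ℕ} (hrank : Function.Injective rank) (i₀ : Fin d) :
    IsFresh (readStack rank) (nextStack rank i₀) (fun s => (actives s.1.1).Finite)
      (fun s => activeFinset s.1.1) remStack where
  good_next s m h := finite_actives_step h
  next_dependsOn s h m m' hm := by
    rw [nextStack, nextFixed_dependsOn h hm, nextStack]
  read_mem s h u hu := Nat.le_add_right _ _
  read_inj s h u hu u' hu' huu' := by
    have hp : (s.1.1 u).place = (s.1.1 u').place := congrArg Prod.fst huu'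
    have hk : s.2 (s.1.1 u).place + position rank s.1.1 u =
      s.2 (s.1.1 u').place + position rank s.1.1 u' := congrArg Prod.snd huu'
    obtain ⟨v, l, hv⟩ := (mem_activeFinset h).1 hu
    obtain ⟨v', l', hv'⟩ := (mem_activeFinset h).1 hu'
    have hx : (v, l) = (v', l') := by simpa [hv, hv', Status.place] using hp
    cases hx
    rw [hp] at hk
    exact (bijOn_position hrank h (v, l)).injOn hv hv' (Nat.add_left_cancel hk)
  rem_next s m h := by
    rintro ⟨x, k⟩ hq
    have hq : s.2 x + (activesAt s.1.1 x).ncard ≤ k := hq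
    refine ⟨(Nat.le_add_right _ _).trans hq, ?_⟩
    rintro ⟨u, hu, he⟩
    obtain ⟨v, l, hv⟩ := (mem_activeFinset h).1 hu
    have hx : (v, l) = x := by simpa [readStack, hv, Status.place] using congrArg Prod.fst he
    subst hx
    have hk : s.2 (v, l) + position rank s.1.1 u = k := by
      simpa [readStack, hv, Status.place] using congrArg Prod.snd he
    have : position rank s.1.1 u < (activesAt s.1.1 (v, l)).ncard :=
      (bijOn_position hrank h (v, l)).mapsTo hv
    omega

end

section

variable {d : ℕ}

/-! ### The number of jumps to the root up to a given time -/

/-- The number of jumps to the root in the first `n` steps. -/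
def visitsUpTo (rank : Vertex d → ℕ) (ω : Env d) (n : ℕ) : ℕ :=
  ∑ k ∈ Finset.range n, (jumpers ω (config rank ω k)).ncard

/-- The initial state. -/
def initialState (d : ℕ) : State d := (initial d, 0)

theorem finite_actives_initial : (actives (initial d)).Finite := by
  refine (Set.finite_singleton []).subset ?_
  rintro u ⟨v, l, hu⟩
  by_contra h
  simp [initial, show u ≠ [] from h] at hu

theorem finite_actives_config (rank : Vertex d → ℕ) (ω : Env d) (n : ℕ) :
    (actives (config rank ω n)).Finite := by
  induction n with
  | zero => exact finite_actives_initial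
  | succ n ih => exact finite_actives_step ih

theorem explore_readEnv_nextState (rank : Vertex d → ℕ) (ω : Env d) (s : State d) :
    explore readEnv (nextState rank) ω s =
      (step rank ω s.1, s.2 + (jumpers ω s.1).ncard) :=
  nextState_congr fun u v l hu => by simp [readEnv, hu, Status.place]

theorem iterate_explore_readEnv (rank : Vertex d → ℕ) (ω : Env d) (n : ℕ) :
    (explore readEnv (nextState rank) ω)^[n] (initialState d) =
      (config rank ω n, visitsUpTo rank ω n) := by
  induction n with
  | zero => rfl
  | succ n ih =>
    rw [Function.iterate_succ_apply', ih, explore_readEnv_nextState, visitsUpTo, visitsUpTo,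
      Finset.sum_range_succ, config]

/-- The next state and odometer, given the moves of the active frogs. -/
def nextPlain (rank : Vertex d → ℕ) (s : State d × Odometer d) (m : Vertex d → Move d) :
    State d × Odometer d :=
  (nextState rank s.1 m, nextOdometer s.1.1 s.2)

/-- The model driven by the stacks `ξ`, after `n` steps. -/
def stackState (rank : Vertex d → ℕ) (ξ : Stack d) (n : ℕ) : State d × Odometer d :=
  (explore (readStack rank) (nextPlain rank) ξ)^[n] (initialState d, 0)

/-- The law of the stacks of instructions: all instructions are independent. -/
def stackLaw (d : ℕ) (p : ℝ) : Measure (Stack d) :=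
  Measure.infinitePi fun q : Place d × ℕ => stepLaw d p q.1.2

theorem stepLaw_fromParent_up (p : ℝ) : stepLaw d p .fromParent {.up} = 0 := by
  simp only [stepLaw, Measure.finsetSum_apply, Measure.smul_apply, smul_eq_mul]
  refine Finset.sum_eq_zero fun m _ => ?_
  rcases m with _ | i
  · simp [stepProb]
  · rw [Measure.dirac_apply' _ (MeasurableSpace.measurableSet_top)]
    simp

instance : MeasurableSingletonClass (Move d) := ⟨fun _ => MeasurableSpace.measurableSet_top⟩

/-- Only an upward step after a downward one is altered, which is a null event for each of countably
many coordinates. So the repaired and the original dynamics agree almost surely. -/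
theorem ae_fixMove_eq {ι : Type*} [Countable ι] (i₀ : Fin d) (p : ℝ) (lab : ι → LastStep d)
    [∀ l, IsProbabilityMeasure (stepLaw d p l)] :
    ∀ᵐ ω ∂Measure.infinitePi fun i => stepLaw d p (lab i),
      (fun i => fixMove i₀ (lab i) (ω i)) = ω := by
  have h : ∀ i, ∀ᵐ ω ∂Measure.infinitePi fun i => stepLaw d p (lab i),
      fixMove i₀ (lab i) (ω i) = ω i := by
    intro i
    have h1 : ∀ᵐ m ∂stepLaw d p (lab i), fixMove i₀ (lab i) m = m := by
      rcases hl : lab i with _ | j | _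
      · exact .of_forall fun m => rfl
      · exact .of_forall fun m => rfl
      · refine measure_mono_null ?_ (stepLaw_fromParent_up p)
        intro m hm
        rcases m with _ | i
        · rfl
        · exact absurd rfl hm
    exact (measurePreserving_eval_infinitePi (fun i => stepLaw d p (lab i)) i).quasiMeasurePreserving.ae h1
  filter_upwards [ae_all_iff.2 h] with ω hω using funext hω

/-- The number of jumps to the root up to a given time has the same law in the model driven by
stacks. -/
theorem integral_visitsUpTo {rank : Vertex d → ℕ} (hrank : Function.Injective rank) (i₀ : Fin d)
    (p : ℝ) [∀ l, IsProbabilityMeasure (stepLaw d p l)] (φ : ℕ → ℝ) (n : ℕ) :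
    ∫ ω, φ (visitsUpTo rank ω n) ∂envLaw d p =
      ∫ ξ, φ (stackState rank ξ n).1.2 ∂stackLaw d p := by
  -- `Prod.fst` forgets the odometer: the transitions of the state do not involve it, and the law of
  -- the entry read depends only on the last step of the frog.
  have h := (isFresh_env rank i₀).integral_explore_eq
    (fun q : Vertex d × Vertex d × LastStep d => stepLaw d p q.2.2) (isFresh_stack hrank i₀)
    (fun q : Place d × ℕ => stepLaw d p q.1.2) Prod.fst (fun s hs => hs) (fun s m => rfl)
    (fun s u => stepLaw d p (s.1 u).place.2) (fun s hs u hu => rfl) (fun s hs u hu => rfl)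
    (fun s => φ s.2) n (initialState d, 0) finite_actives_initial
  -- Repairing the moves amounts to running the original dynamics in a repaired environment.
  have h1 : ∀ ω : Env d, explore readEnv (nextFixed rank i₀) ω =
      explore readEnv (nextState rank) fun q => fixMove i₀ q.2.2 (ω q) := fun _ => rfl
  have h2 : ∀ ξ : Stack d, explore (readStack rank) (nextStack rank i₀) ξ =
      explore (readStack rank) (nextPlain rank) fun q => fixMove i₀ q.1.2 (ξ q) := fun _ => rfl
  simp only [h1, h2, iterate_explore_readEnv] at h
  refine .trans (integral_congr_ae ?_) (h.trans (integral_congr_ae ?_))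
  · filter_upwards [ae_fixMove_eq i₀ p fun q : Vertex d × Vertex d × LastStep d => q.2.2] with ω hω
    rw [hω]
  · filter_upwards [ae_fixMove_eq i₀ p fun q : Place d × ℕ => q.1.2] with ξ hξ
    rw [hξ, stackState]

theorem measurable_visitsUpTo (rank : Vertex d → ℕ) (n : ℕ) :
    Measurable fun ω => visitsUpTo rank ω n := by
  have h := isCylinder_explore (read := readEnv) (next := nextState rank)
    (good := fun s => (actives s.1).Finite) (act := fun s => activeFinset s.1)
    (rem := fun _ => Set.univ) (fun s m h => finite_actives_step h)
    (fun s h => nextState_dependsOn h) (fun _ _ _ _ => Set.mem_univ _)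
    (fun _ _ _ => Set.subset_univ _) n (initialState d) finite_actives_initial
  simpa only [iterate_explore_readEnv] using (h.comp Prod.snd).measurable

/-! ### The odometer of the model driven by stacks -/

/-- The number of exits from the place `x` with the step `m`. -/
def exits (ξ : Stack d) (O : Odometer d) (x : Place d) (m : Move d) : ℕ :=
  Nat.count (fun k => ξ (x, k) = m) (O x)

/-- The number of upward jumps from the vertex `v`. -/
def upExits (ξ : Stack d) (O : Odometer d) (v : Vertex d) : ℕ :=
  ∑ l, exits ξ O (v, l) .up

/-- The vertices visited by the frogs. -/
def Visited (ξ : Stack d) (O : Odometer d) : Vertex d → Prop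
  | [] => True
  | i :: v => ∃ l, 0 < exits ξ O (v, l) (.down i)

open Classical in
/-- The number of arrivals at each place, given the numbers of exits. -/
def arrivals (ξ : Stack d) (O : Odometer d) : Odometer d
  | (v, .origin) => if v ≠ [] ∧ Visited ξ O v then 1 else 0
  | (v, .fromParent) => if Visited ξ O v then 1 else 0
  | (v, .fromChild j) => if v = [] then 0 else upExits ξ O (j :: v)

/-- The number of jumps to the root. -/
def rootExits (ξ : Stack d) (O : Odometer d) : ℕ :=
  upExits ξ O [] + ∑ j, upExits ξ O [j]

/-- The relation between a state of the model driven by stacks and the odometer. -/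
structure IsConsistent (ξ : Stack d) (s : State d × Odometer d) : Prop where
  finite_actives : (actives s.1.1).Finite
  arrivals_eq : nextOdometer s.1.1 s.2 = arrivals ξ s.2
  asleep_iff : ∀ v, s.1.1 v = .asleep ↔ ¬ Visited ξ s.2 v
  awake_site : ∀ u v l, s.1.1 u = .active v l → s.1.1 v ≠ .asleep
  awake_parent : ∀ j v, s.1.1 (j :: v) ≠ .asleep → s.1.1 v ≠ .asleep
  visits_eq : s.1.2 = rootExits ξ s.2

theorem exits_zero (ξ : Stack d) (x : Place d) (m : Move d) : exits ξ 0 x m = 0 := by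
  simp [exits]

theorem isConsistent_initial (ξ : Stack d) : IsConsistent ξ (initialState d, 0) where
  finite_actives := finite_actives_initial
  arrivals_eq := by
    have h0 : ∀ v l, (v, l) ≠ (([], .fromParent) : Place d) → activesAt (initial d) (v, l) = ∅ := by
      intro v l h
      refine Set.eq_empty_of_forall_notMem fun u hu => ?_
      have hu : initial d u = .active v l := hu
      by_cases hu' : u = []
      · simp only [initial, hu', if_true, Status.active.injEq] at hu
        exact h (by rw [← hu.1, ← hu.2])
      · simp [initial, hu'] at hu
    have h1 : activesAt (initial d) ([], .fromParent) = {[]} := by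
      ext u
      by_cases hu : u = [] <;> simp [activesAt, initial, hu]
    funext ⟨v, l⟩
    simp only [nextOdometer, initialState, Pi.zero_apply, zero_add]
    rcases v with _ | ⟨i, v⟩ <;> rcases l with _ | j | _ <;>
      simp [h0, h1, arrivals, Visited, exits_zero, upExits]
  asleep_iff v := by
    rcases v with _ | ⟨i, v⟩ <;> simp [initialState, initial, Visited, exits_zero]
  awake_site u v l h := by
    by_cases hu : u = []
    · simp only [initialState, initial, hu, if_true, Status.active.injEq] at h
      simp [initialState, initial, ← h.1]
    · simp [initialState, initial, hu] at h
  awake_parent j v h := absurd (by simp [initialState, initial]) h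
  visits_eq := by simp [initialState, rootExits, upExits, exits_zero]

theorem ncard_fiberwise {U κ : Type*} [Fintype κ] {A : Set U} (hA : A.Finite) (f : U → κ) :
    A.ncard = ∑ k, {u ∈ A | f u = k}.ncard := by
  classical
  have h := Finset.card_eq_sum_card_fiberwise (s := hA.toFinset) (t := Finset.univ) (f := f)
    (fun _ _ => by simp)
  rw [Set.ncard_eq_toFinset_card A hA, h]
  refine Finset.sum_congr rfl fun k _ => ?_
  rw [← Set.ncard_coe_finset]
  congr 1
  ext u
  simp

/-- The moves of the frogs, as an environment. -/
def stackEnv (rank : Vertex d → ℕ) (ξ : Stack d) (s : State d × Odometer d) : Env d :=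
  fun q => ξ (readStack rank s q.1)

/-! ### Conservation laws in one time step -/

section Next

variable {rank : Vertex d → ℕ} {ξ : Stack d} {s : State d × Odometer d}

/-- The frogs present at `x` use up the entries that follow the first `s.2 x` ones, bijectively, so
counting entries is the same as counting frogs. -/
theorem IsConsistent.exits_next (hrank : Function.Injective rank) (hs : IsConsistent ξ s)
    (x : Place d) (m : Move d) :
    exits ξ (nextOdometer s.1.1 s.2) x m = exits ξ s.2 x m +
      {u ∈ activesAt s.1.1 x | ξ (readStack rank s u) = m}.ncard := by
  rw [exits, nextOdometer, Nat.count_add, ← exits, Nat.count_eq_card_filter_range,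
    ← Set.ncard_coe_finset]
  have hb := bijOn_position hrank hs.finite_actives x
  congr 1
  have h : ((Finset.range (activesAt s.1.1 x).ncard).filter
      fun k => ξ (x, s.2 x + k) = m : Finset ℕ) =
      position rank s.1.1 '' {u ∈ activesAt s.1.1 x | ξ (readStack rank s u) = m} := by
    have hread : ∀ u ∈ activesAt s.1.1 x,
        readStack rank s u = (x, s.2 x + position rank s.1.1 u) := by
      intro u hu
      have : (s.1.1 u).place = x := by rw [show s.1.1 u = _ from hu]; rfl
      simp only [readStack, this]
    ext k
    simp only [Finset.coe_filter, Finset.mem_range, Set.mem_ofPred_eq, Set.mem_image]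
    constructor
    · rintro ⟨hk, hm⟩
      obtain ⟨u, hu, rfl⟩ := hb.surjOn (Set.mem_Iio.2 hk)
      exact ⟨u, ⟨hu, by rw [hread u hu, hm]⟩, rfl⟩
    · rintro ⟨u, ⟨hu, hm⟩, rfl⟩
      exact ⟨hb.mapsTo hu, by rw [← hread u hu, hm]⟩
  rw [h, (hb.injOn.mono fun u hu => hu.1).ncard_image]

/-- A sleeping frog can only be visited from its parent vertex. -/
theorem IsConsistent.attempts_down (hs : IsConsistent ξ s) {η : Env d} {u v : Vertex d}
    (hv : s.1.1 v = .asleep) (h : Attempts η s.1.1 u v) :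
    ∃ i w l, v = i :: w ∧ s.1.1 u = .active w l ∧ η (u, w, l) = .down i := by
  obtain ⟨w, l, hu, hd⟩ := h
  have hw := hs.awake_site _ _ _ hu
  rcases hm : η (u, w, l) with _ | i
  · rw [hm] at hd
    rcases w with _ | ⟨j, w⟩
    · obtain rfl : [] = v := hd
      exact absurd hv hw
    · obtain rfl : w = v := hd
      exact absurd hv (hs.awake_parent _ _ hw)
  · rw [hm] at hd
    exact ⟨i, w, l, hd.symm, hu, hm⟩

theorem IsConsistent.finite_activesAt (hs : IsConsistent ξ s) (x : Place d) :
    (activesAt s.1.1 x).Finite :=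
  hs.finite_actives.subset (activesAt_subset _ x)

theorem IsConsistent.visited_next (hrank : Function.Injective rank) (hs : IsConsistent ξ s)
    (v : Vertex d) : Visited ξ (nextOdometer s.1.1 s.2) v ↔
      Visited ξ s.2 v ∨ ∃ u, Attempts (stackEnv rank ξ s) s.1.1 u v := by
  rcases v with _ | ⟨i, w⟩
  · simp [Visited]
  · constructor
    · rintro ⟨l, hl⟩
      rw [hs.exits_next hrank] at hl
      rcases Nat.eq_zero_or_pos (exits ξ s.2 (w, l) (.down i)) with h0 | h0
      · rw [h0, zero_add, Set.ncard_pos ((hs.finite_activesAt _).subset fun _ h => h.1)] at hl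
        obtain ⟨u, hu, hm⟩ := hl
        exact .inr ⟨u, w, l, hu, by simp [stackEnv, hm, Move.dest]⟩
      · exact .inl ⟨l, h0⟩
    · intro h
      by_cases hv : Visited ξ s.2 (i :: w)
      · obtain ⟨l, hl⟩ := hv
        exact ⟨l, hl.trans_le (by rw [hs.exits_next hrank]; exact Nat.le_add_right _ _)⟩
      · obtain ⟨u, hu⟩ := h.resolve_left hv
        obtain ⟨i', w', l, he, hu, hm⟩ := hs.attempts_down ((hs.asleep_iff _).2 hv) hu
        cases he
        refine ⟨l, ?_⟩
        rw [hs.exits_next hrank]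
        refine Nat.add_pos_right _ ?_
        rw [Set.ncard_pos ((hs.finite_activesAt _).subset fun _ h => h.1)]
        exact ⟨u, hu, hm⟩

theorem IsConsistent.upExits_next (hrank : Function.Injective rank) (hs : IsConsistent ξ s)
    (v : Vertex d) : upExits ξ (nextOdometer s.1.1 s.2) v = upExits ξ s.2 v +
      {u | (∃ l, s.1.1 u = .active v l) ∧ ξ (readStack rank s u) = .up}.ncard := by
  have hfin : {u | (∃ l, s.1.1 u = .active v l) ∧ ξ (readStack rank s u) = .up}.Finite :=
    hs.finite_actives.subset fun u hu => ⟨v, hu.1⟩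
  simp only [upExits, hs.exits_next hrank, Finset.sum_add_distrib]
  rw [ncard_fiberwise hfin fun u => (s.1.1 u).place.2]
  congr! 4 with l - 
  ext u
  constructor
  · rintro ⟨hu, hm⟩
    exact ⟨⟨⟨l, hu⟩, hm⟩, by rw [show s.1.1 u = _ from hu]; rfl⟩
  · rintro ⟨⟨⟨l', hu⟩, hm⟩, hl⟩
    rw [hu] at hl
    obtain rfl : l' = l := hl
    exact ⟨hu, hm⟩

theorem IsConsistent.activesAt_next_fromChild (v : Vertex d) (j : Fin d) (hv : v ≠ []) :
    activesAt (step rank (stackEnv rank ξ s) s.1.1) (v, .fromChild j) =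
      {u | (∃ l, s.1.1 u = .active (j :: v) l) ∧ ξ (readStack rank s u) = .up} := by
  ext u
  refine step_eq_active_iff.trans ?_
  constructor
  · rintro (⟨-, -, -, h⟩ | ⟨j', l', hu, hm, -, h⟩ | ⟨i, v', l', -, -, -, -, h⟩)
    · simp at h
    · cases h
      exact ⟨⟨l', hu⟩, hm⟩
    · simp at h
  · rintro ⟨⟨l, hu⟩, hm⟩
    exact .inr <| .inl ⟨j, l, hu, hm, hv, rfl⟩

theorem IsConsistent.activesAt_next_root (hs : IsConsistent ξ s) (l : LastStep d) :
    activesAt (step rank (stackEnv rank ξ s) s.1.1) ([], l) = ∅ := by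
  refine Set.eq_empty_of_forall_notMem fun u hu => ?_
  rcases step_eq_active_iff.1 hu with ⟨h1, -, h, -⟩ | ⟨j', l', -, -, h, -⟩ | ⟨i, v', l', -, -, -, h, -⟩
  · have h : [] = u := h
    subst h
    exact (hs.asleep_iff _).1 h1 trivial
  · exact h rfl
  · simp at h

theorem IsConsistent.ncard_activesAt_next_origin (hs : IsConsistent ξ s) (v : Vertex d) :
    (activesAt (step rank (stackEnv rank ξ s) s.1.1) (v, .origin)).ncard =
      open Classical in
      if ¬ Visited ξ s.2 v ∧ ∃ u, Attempts (stackEnv rank ξ s) s.1.1 u v then 1 else 0 := by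
  have h : ∀ u, u ∈ activesAt (step rank (stackEnv rank ξ s) s.1.1) (v, .origin) ↔
      u = v ∧ ¬ Visited ξ s.2 v ∧ ∃ u, Attempts (stackEnv rank ξ s) s.1.1 u v := by
    intro u
    refine step_eq_active_iff.trans ?_
    constructor
    · rintro (⟨h1, h2, rfl, -⟩ | ⟨j', l', hu, hm, -, h⟩ | ⟨i, v', l', -, -, -, -, h⟩)
      · exact ⟨rfl, (hs.asleep_iff _).1 h1, h2⟩
      · simp at h
      · simp at h
    · rintro ⟨rfl, h1, h2⟩
      exact .inl ⟨(hs.asleep_iff _).2 h1, h2, rfl, rfl⟩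
  split_ifs with hv
  · rw [Set.ncard_eq_one]
    exact ⟨v, Set.ext fun u => by simp [h, hv]⟩
  · rw [Set.eq_empty_of_forall_notMem fun u hu => hv ((h u).1 hu).2, Set.ncard_empty]

/-- On a first visit exactly the frog of least rank is let in. The number let in is thus 1 for every
priority order, which is where the dependence on `rank` disappears. -/
theorem IsConsistent.ncard_activesAt_next_fromParent (hrank : Function.Injective rank)
    (hs : IsConsistent ξ s) (v : Vertex d) :
    (activesAt (step rank (stackEnv rank ξ s) s.1.1) (v, .fromParent)).ncard =
      open Classical in
      if ¬ Visited ξ s.2 v ∧ ∃ u, Attempts (stackEnv rank ξ s) s.1.1 u v then 1 else 0 := by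
  have h : ∀ u, u ∈ activesAt (step rank (stackEnv rank ξ s) s.1.1) (v, .fromParent) ↔
      Attempts (stackEnv rank ξ s) s.1.1 u v ∧
        Admitted rank (stackEnv rank ξ s) s.1.1 u v := by
    intro u
    refine step_eq_active_iff.trans ?_
    constructor
    · rintro (⟨-, -, -, h⟩ | ⟨j', l', hu, hm, -, h⟩ | ⟨i, v', l', hu, hm, ha, rfl, -⟩)
      · simp at h
      · simp at h
      · exact ⟨⟨v', l', hu, by rw [hm]; rfl⟩, ha⟩
    · rintro ⟨h1, h2⟩
      obtain ⟨i, w, l, rfl, hu, hm⟩ := hs.attempts_down h2.1 h1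
      exact .inr <| .inr ⟨i, w, l, hu, hm, h2, rfl, rfl⟩
  split_ifs with hv
  · rw [Set.ncard_eq_one]
    obtain ⟨h1, h2⟩ := hv
    obtain ⟨u, hu, hmin⟩ := WellFounded.has_min (measure rank).wf {u | Attempts _ _ u v} h2
    refine ⟨u, Set.ext fun u' => ⟨fun hu' => ?_, fun hu' => ?_⟩⟩
    · obtain ⟨ha, -, hmin'⟩ := (h u').1 hu'
      exact hrank (le_antisymm (hmin' u hu) (not_lt.1 (hmin u' ha)))
    · obtain rfl : u' = u := hu'
      exact (h u').2 ⟨hu, (hs.asleep_iff _).2 h1, fun u'' hu'' => not_lt.1 (hmin u'' hu'')⟩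
  · have h0 := Set.eq_empty_of_forall_notMem fun u hu =>
      hv ⟨(hs.asleep_iff _).1 ((h u).1 hu).2.1, u, ((h u).1 hu).1⟩
    rw [h0, Set.ncard_empty]

theorem IsConsistent.ncard_jumpers (hrank : Function.Injective rank) (hs : IsConsistent ξ s) :
    rootExits ξ (nextOdometer s.1.1 s.2) =
      rootExits ξ s.2 + (jumpers (stackEnv rank ξ s) s.1.1).ncard := by
  have hfin : (jumpers (stackEnv rank ξ s) s.1.1).Finite :=
    hs.finite_actives.subset fun u hu => hu.mem_actives
  -- The head of the site tells a frog at the root (`none`) from one at the child `j` (`some j`).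
  -- The impossible upward step from the root counts as a jump to the root as well, so the identity
  -- holds for every `ξ`.
  rw [ncard_fiberwise hfin fun u => (s.1.1 u).place.1.head?, Fintype.sum_option]
  simp only [rootExits, hs.upExits_next hrank, Finset.sum_add_distrib]
  have h : ∀ u, u ∈ jumpers (stackEnv rank ξ s) s.1.1 ↔
      ((∃ l, s.1.1 u = .active [] l) ∧ ξ (readStack rank s u) = .up) ∨
      ∃ j, (∃ l, s.1.1 u = .active [j] l) ∧ ξ (readStack rank s u) = .up := by
    intro u
    constructor
    · rintro ⟨v, l, hu, hd⟩
      rcases hm : ξ (readStack rank s u) with _ | i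
      · rw [stackEnv, hm] at hd
        rcases v with _ | ⟨j, v⟩
        · exact .inl ⟨⟨l, hu⟩, rfl⟩
        · obtain rfl : v = [] := hd
          exact .inr ⟨j, ⟨l, hu⟩, rfl⟩
      · rw [stackEnv, hm] at hd
        simp [Move.dest] at hd
    · rintro (⟨⟨l, hu⟩, hm⟩ | ⟨j, ⟨l, hu⟩, hm⟩) <;>
        exact ⟨_, l, hu, by simp [stackEnv, hm, Move.dest]⟩
  have h0 : {u ∈ jumpers (stackEnv rank ξ s) s.1.1 | (s.1.1 u).place.1.head? = none} =
      {u | (∃ l, s.1.1 u = .active [] l) ∧ ξ (readStack rank s u) = .up} := by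
    ext u
    simp only [Set.mem_ofPred_eq, h]
    constructor
    · rintro ⟨h | ⟨j, ⟨l, hu⟩, hm⟩, h'⟩
      · exact h
      · simp [hu, Status.place] at h'
    · rintro ⟨⟨l, hu⟩, hm⟩
      exact ⟨.inl ⟨⟨l, hu⟩, hm⟩, by simp [hu, Status.place]⟩
  have h1 : ∀ j, {u ∈ jumpers (stackEnv rank ξ s) s.1.1 | (s.1.1 u).place.1.head? = some j} =
      {u | (∃ l, s.1.1 u = .active [j] l) ∧ ξ (readStack rank s u) = .up} := by
    intro j
    ext u
    simp only [Set.mem_ofPred_eq, h]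
    constructor
    · rintro ⟨⟨⟨l, hu⟩, hm⟩ | ⟨j', ⟨l, hu⟩, hm⟩, h'⟩
      · simp [hu, Status.place] at h'
      · simp only [hu, Status.place, List.head?_cons, Option.some.injEq] at h'
        subst h'
        exact ⟨⟨l, hu⟩, hm⟩
    · rintro ⟨⟨l, hu⟩, hm⟩
      exact ⟨.inr ⟨j, ⟨l, hu⟩, hm⟩, by simp [hu, Status.place]⟩
  rw [h0]
  simp only [h1]
  omega

/-- The field `arrivals_eq` is conservation of frogs: those that have left a place and those still
there make up all that ever arrived, and arrivals are determined by exits from neighbouring places.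
It turns the odometer into an iteration of `arrivals ξ`. -/
theorem IsConsistent.next (hrank : Function.Injective rank) (hs : IsConsistent ξ s) :
    IsConsistent ξ (explore (readStack rank) (nextPlain rank) ξ s) where
  finite_actives := finite_actives_step hs.finite_actives
  arrivals_eq := by
    classical
    funext ⟨v, l⟩
    have hO := congrFun hs.arrivals_eq
    change nextOdometer s.1.1 s.2 (v, l) +
      (activesAt (step rank (stackEnv rank ξ s) s.1.1) (v, l)).ncard =
        arrivals ξ (nextOdometer s.1.1 s.2) (v, l)
    rcases l with _ | j | _
    · rw [hs.ncard_activesAt_next_origin, hO]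
      simp only [arrivals, hs.visited_next hrank]
      by_cases hv : v = []
      · simp [hv, Visited]
      · by_cases h : Visited ξ s.2 v <;> simp [hv, h]
    · by_cases hv : v = []
      · subst hv
        rw [hs.activesAt_next_root, Set.ncard_empty, hO]
        simp [arrivals]
      · rw [activesAt_next_fromChild v j hv, hO]
        simp [arrivals, hv, hs.upExits_next hrank]
    · rw [hs.ncard_activesAt_next_fromParent hrank, hO]
      simp only [arrivals, hs.visited_next hrank]
      by_cases h : Visited ξ s.2 v <;> simp [h]
  asleep_iff v := by
    change step rank (stackEnv rank ξ s) s.1.1 v = _ ↔ ¬ Visited ξ (nextOdometer s.1.1 s.2) v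
    rw [step_asleep_iff, hs.visited_next hrank, hs.asleep_iff, not_or]
  awake_site u v l h := by
    change step rank (stackEnv rank ξ s) s.1.1 v ≠ _
    rw [Ne, step_asleep_iff, not_and_not_right]
    intro hv
    rcases step_eq_active_iff.1 h with ⟨-, h, rfl, -⟩ | ⟨j, l', hu, -, -, -⟩ |
      ⟨i, v', l', hu, hm, -, rfl, -⟩
    · exact h
    · exact absurd hv (hs.awake_parent _ _ (hs.awake_site _ _ _ hu))
    · exact ⟨u, v', l', hu, by rw [show stackEnv rank ξ s _ = _ from hm]; rfl⟩
  awake_parent j v h := by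
    change step rank (stackEnv rank ξ s) s.1.1 (j :: v) ≠ _ at h
    change step rank (stackEnv rank ξ s) s.1.1 v ≠ _
    rw [Ne, step_asleep_iff, not_and_not_right] at h ⊢
    intro hv
    have hj : s.1.1 (j :: v) = .asleep := not_not.1 fun hj => hs.awake_parent _ _ hj hv
    obtain ⟨u, hu⟩ := h hj
    obtain ⟨i, w, l, he, hu, -⟩ := hs.attempts_down hj hu
    cases he
    exact absurd hv (hs.awake_site _ _ _ hu)
  visits_eq := by
    change s.1.2 + (jumpers (stackEnv rank ξ s) s.1.1).ncard =
      rootExits ξ (nextOdometer s.1.1 s.2)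
    rw [hs.ncard_jumpers hrank, hs.visits_eq]

end Next

theorem isConsistent_stackState {rank : Vertex d → ℕ} (hrank : Function.Injective rank)
    (ξ : Stack d) (n : ℕ) : IsConsistent ξ (stackState rank ξ n) := by
  induction n with
  | zero => exact isConsistent_initial ξ
  | succ n ih =>
    rw [stackState, Function.iterate_succ_apply']
    exact ih.next hrank

/-- The odometer of the model driven by stacks, which does not depend on the priorities. -/
theorem stackState_visits {rank : Vertex d → ℕ} (hrank : Function.Injective rank) (ξ : Stack d)
    (n : ℕ) : (stackState rank ξ n).1.2 = rootExits ξ ((arrivals ξ)^[n] 0) := by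
  have h : (stackState rank ξ n).2 = (arrivals ξ)^[n] 0 := by
    induction n with
    | zero => rfl
    | succ n ih =>
      rw [Function.iterate_succ_apply', ← ih, ← (isConsistent_stackState hrank ξ n).arrivals_eq,
        stackState, Function.iterate_succ_apply']
      rfl
  rw [(isConsistent_stackState hrank ξ n).visits_eq, h]

end

section

variable {d : ℕ}

/-! ### The number of returns as a recursion over the tree -/

/-- The number of steps `m` among the first `n` instructions at the place `x`. -/
def instrCount (ξ : Stack d) (x : Place d) (m : Move d) (n : ℕ) : ℕ :=
  Nat.count (fun k => ξ (x, k) = m) n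

theorem instrCount_mono (ξ : Stack d) (x : Place d) (m : Move d) : Monotone (instrCount ξ x m) :=
  Nat.count_monotone _

@[simp]
theorem instrCount_zero (ξ : Stack d) (x : Place d) (m : Move d) : instrCount ξ x m 0 = 0 := by
  simp [instrCount]

theorem instrCount_one_pos {ξ : Stack d} {x : Place d} {m : Move d} :
    0 < instrCount ξ x m 1 ↔ ξ (x, 0) = m := by
  by_cases h : ξ (x, 0) = m <;> simp [instrCount, Nat.count_succ, h]

/-- The closure of `I` under the relations `j → i` for `i ∈ D j`. -/
inductive Reach {κ : Type*} (I : Set κ) (D : κ → Set κ) : κ → Prop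
  | base {i : κ} : i ∈ I → Reach I D i
  | step {i j : κ} : Reach I D j → i ∈ D j → Reach I D i

/-- The children of `v` that are entered by the first two frogs at `v`. -/
def startSet (ξ : Stack d) (v : Vertex d) : Set (Fin d) :=
  {i | ξ ((v, .origin), 0) = .down i ∨ ξ ((v, .fromParent), 0) = .down i}

/-- The children of `v` chosen by the first `n` frogs that come up from the `j`-th child of `v`. -/
def jumpSet (ξ : Stack d) (v : Vertex d) (j : Fin d) (n : ℕ) : Set (Fin d) :=
  {i | 0 < instrCount ξ (v, .fromChild j) (.down i) n}

open Classical in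
/-- The number of upward jumps from the vertex `v` once it is visited, when all frogs more than `D`
levels below the parent of `v` are removed. -/
def returns (ξ : Stack d) : ℕ → Vertex d → ℕ
  | 0, _ => 0
  | D + 1, v => instrCount ξ (v, .origin) .up 1 + instrCount ξ (v, .fromParent) .up 1 +
      ∑ j, if Reach (startSet ξ v) (fun j => jumpSet ξ v j (returns ξ D (j :: v))) j then
        instrCount ξ (v, .fromChild j) .up (returns ξ D (j :: v)) else 0

open Classical in
/-- The number of jumps to the root when all frogs more than `D` levels below it are removed. -/
def rootReturns (ξ : Stack d) (D : ℕ) : ℕ :=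
  instrCount ξ ([], .fromParent) .up 1 +
    ∑ j, if ξ (([], .fromParent), 0) = .down j then returns ξ D [j] else 0

/-! ### Comparison of the odometer with the truncated recursion -/

theorem sum_lastStep (f : LastStep d → ℕ) :
    ∑ l, f l = f .origin + f .fromParent + ∑ j, f (.fromChild j) := by
  let e : Option (Option (Fin d)) ≃ LastStep d :=
    { toFun := fun o => match o with
        | none => .origin
        | some none => .fromParent
        | some (some j) => .fromChild j
      invFun := fun l => match l with
        | .origin => none
        | .fromParent => some none
        | .fromChild j => some (some j)
      left_inv := by rintro (_ | _ | j) <;> rfl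
      right_inv := by rintro (_ | j | _) <;> rfl }
  rw [← e.sum_comp, Fintype.sum_option, Fintype.sum_option, add_assoc]
  rfl

theorem upExits_eq (ξ : Stack d) (O : Odometer d) (v : Vertex d) :
    upExits ξ O v = instrCount ξ (v, .origin) .up (O (v, .origin)) +
      instrCount ξ (v, .fromParent) .up (O (v, .fromParent)) +
      ∑ j, instrCount ξ (v, .fromChild j) .up (O (v, .fromChild j)) :=
  sum_lastStep _

theorem upExits_mono (ξ : Stack d) (v : Vertex d) : Monotone fun O => upExits ξ O v :=
  fun _ _ h => Finset.sum_le_sum fun _ _ => Nat.count_monotone _ (h _)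

theorem visited_mono {ξ : Stack d} {O O' : Odometer d} (h : O ≤ O') {v : Vertex d}
    (hv : Visited ξ O v) : Visited ξ O' v := by
  rcases v with _ | ⟨i, v⟩
  · trivial
  · obtain ⟨l, hl⟩ := hv
    exact ⟨l, hl.trans_le (Nat.count_monotone _ (h _))⟩

/-- Started from 0, the iterates of a monotone map increase, so the odometer has a limit in which
the order of events plays no role. -/
theorem arrivals_mono (ξ : Stack d) : Monotone (arrivals ξ) := by
  classical
  rintro O O' h ⟨v, l⟩
  rcases l with _ | j | _
  · simp only [arrivals]
    split_ifs with h1 h2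
    · exact le_rfl
    · exact absurd ⟨h1.1, visited_mono h h1.2⟩ h2
    · exact zero_le_one
    · exact le_rfl
  · simp only [arrivals]
    split_ifs
    · exact le_rfl
    · exact upExits_mono ξ _ h
  · simp only [arrivals]
    split_ifs with h1 h2
    · exact le_rfl
    · exact absurd (visited_mono h h1) h2
    · exact zero_le_one
    · exact le_rfl

/-- The odometer after `n` steps of the model driven by the stacks `ξ`. -/
def odometer (ξ : Stack d) (n : ℕ) : Odometer d := (arrivals ξ)^[n] 0

theorem odometer_succ (ξ : Stack d) (n : ℕ) : odometer ξ (n + 1) = arrivals ξ (odometer ξ n) :=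
  Function.iterate_succ_apply' _ _ _

theorem odometer_mono (ξ : Stack d) : Monotone (odometer ξ) :=
  (arrivals_mono ξ).monotone_iterate_of_le_map fun _ => Nat.zero_le _

theorem rootExits_mono (ξ : Stack d) : Monotone fun n => rootExits ξ (odometer ξ n) :=
  fun _ _ h => add_le_add (upExits_mono ξ _ (odometer_mono ξ h))
    (Finset.sum_le_sum fun _ _ => upExits_mono ξ _ (odometer_mono ξ h))

theorem pos_of_instrCount_pos {ξ : Stack d} {x : Place d} {m : Move d} {n : ℕ}
    (h : 0 < instrCount ξ x m n) : 0 < n :=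
  Nat.pos_of_ne_zero fun h0 => by simp [h0] at h

theorem exists_pos_of_upExits_pos {ξ : Stack d} {O : Odometer d} {v : Vertex d}
    (h : 0 < upExits ξ O v) : ∃ l, 0 < O (v, l) := by
  obtain ⟨l, -, hl⟩ := Finset.sum_pos_iff.1 h
  exact ⟨l, pos_of_instrCount_pos hl⟩

theorem visited_of_odometer_pos {ξ : Stack d} {n : ℕ} : ∀ {v l}, 0 < odometer ξ n (v, l) →
    Visited ξ (odometer ξ n) v := by
  classical
  induction n with
  | zero => exact fun h => absurd h (lt_irrefl 0)
  | succ n ih =>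
    intro v l h
    refine visited_mono (odometer_mono ξ n.le_succ) ?_
    rw [odometer_succ] at h
    rcases l with _ | j | _ <;> simp only [arrivals] at h <;> split_ifs at h with hv
    · exact hv.2
    · simp at h
    · simp at h
    -- A frog that comes up from a child has left a visited child, which was entered from `v`; so
    -- some frog had already been at `v`.
    · obtain ⟨l, hl⟩ := exists_pos_of_upExits_pos h
      obtain ⟨l', hl'⟩ := ih hl
      exact ih (pos_of_instrCount_pos hl')
    · exact hv
    · simp at h

theorem visited_of_upExits_pos {ξ : Stack d} {n : ℕ} {v : Vertex d}
    (h : 0 < upExits ξ (odometer ξ n) v) : Visited ξ (odometer ξ n) v :=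
  let ⟨_, hl⟩ := exists_pos_of_upExits_pos h
  visited_of_odometer_pos hl

theorem arrivals_origin_le (ξ : Stack d) (O : Odometer d) (v : Vertex d) :
    arrivals ξ O (v, .origin) ≤ 1 := by
  simp only [arrivals]
  split_ifs <;> simp

theorem arrivals_fromParent_le (ξ : Stack d) (O : Odometer d) (v : Vertex d) :
    arrivals ξ O (v, .fromParent) ≤ 1 := by
  simp only [arrivals]
  split_ifs <;> simp

theorem arrivals_fromChild_le (ξ : Stack d) (O : Odometer d) (v : Vertex d) (j : Fin d) :
    arrivals ξ O (v, .fromChild j) ≤ upExits ξ O (j :: v) := by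
  simp only [arrivals]
  split_ifs <;> simp

/-- Induction on time: a child is first entered by one of the two initial frogs at `v`, or by a frog
that came up from a child visited earlier. The bound `hn` places the instruction of the latter among
those counted by `returns`. -/
theorem reach_of_visited {ξ : Stack d} {n D : ℕ}
    (hn : ∀ n' ≤ n, ∀ v, upExits ξ (odometer ξ n') v ≤ returns ξ D v) (v : Vertex d) :
    ∀ i, Visited ξ (odometer ξ n) (i :: v) →
      Reach (startSet ξ v) (fun j => jumpSet ξ v j (returns ξ D (j :: v))) i := by
  induction n with
  | zero =>
    rintro i ⟨l, hl⟩
    exact absurd (pos_of_instrCount_pos hl) (lt_irrefl 0)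
  | succ n ih =>
    rintro i ⟨l, hl⟩
    change 0 < instrCount ξ (v, l) (.down i) (odometer ξ (n + 1) (v, l)) at hl
    rw [odometer_succ] at hl
    rcases l with _ | j | _
    · exact .base (.inl (instrCount_one_pos.1
        (hl.trans_le (instrCount_mono ξ _ _ (arrivals_origin_le ξ _ v)))))
    · have h := hl.trans_le (instrCount_mono ξ _ _ (arrivals_fromChild_le ξ _ v j))
      exact .step (ih (fun n' h => hn n' (h.trans n.le_succ)) j
        (visited_of_upExits_pos (pos_of_instrCount_pos h)))
        (h.trans_le (instrCount_mono ξ _ _ (hn n n.le_succ _)))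
    · exact .base (.inr (instrCount_one_pos.1
        (hl.trans_le (instrCount_mono ξ _ _ (arrivals_fromParent_le ξ _ v)))))

/-- What happens at a vertex by time n + 1 depends on its children only up to time n. So the frogs
removed at depth D have no influence up to time D. -/
theorem upExits_le_returns {ξ : Stack d} : ∀ {D n : ℕ}, n ≤ D → ∀ v,
    upExits ξ (odometer ξ n) v ≤ returns ξ D v := by
  classical
  intro D
  induction D with
  | zero =>
    intro n hn v
    obtain rfl : n = 0 := Nat.le_zero.1 hn
    simp [upExits, odometer, exits_zero]
  | succ D ih =>
    intro n hn v
    rcases n with _ | n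
    · simp [upExits, odometer, exits_zero]
    have hn : n ≤ D := Nat.le_of_succ_le_succ hn
    rw [upExits_eq, returns, odometer_succ]
    refine add_le_add (add_le_add (instrCount_mono ξ _ _ (arrivals_origin_le ξ _ v))
      (instrCount_mono ξ _ _ (arrivals_fromParent_le ξ _ v))) (Finset.sum_le_sum fun j _ => ?_)
    refine (instrCount_mono ξ _ _ (arrivals_fromChild_le ξ _ v j)).trans ?_
    split_ifs with hj
    · exact instrCount_mono ξ _ _ (ih hn _)
    · refine Nat.le_zero.2 (Nat.eq_zero_of_not_pos fun h => hj ?_)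
      exact reach_of_visited (fun n' h => ih (h.trans hn)) v j
        (visited_of_upExits_pos (pos_of_instrCount_pos h))

theorem rootExits_le_rootReturns {ξ : Stack d} {n D : ℕ} (h : n ≤ D) :
    rootExits ξ (odometer ξ n) ≤ rootReturns ξ D := by
  classical
  -- Only the initial frog ever acts at the root, since all frogs that jump there are killed.
  have hroot : ∀ l, odometer ξ n ([], l) ≤ if l = .fromParent then 1 else 0 := by
    intro l
    rcases n with _ | n
    · simp [odometer]
    · rw [odometer_succ]
      rcases l with _ | j | _ <;> simp [arrivals]
      split_ifs <;> simp
  refine add_le_add ?_ (Finset.sum_le_sum fun j _ => ?_)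
  · have h1 := hroot .origin
    have h2 := fun j => hroot (.fromChild j)
    simp only [reduceCtorEq, if_false, Nat.le_zero] at h1 h2
    rw [upExits_eq, h1]
    simp only [h2, instrCount_zero, Finset.sum_const_zero, zero_add, add_zero]
    exact instrCount_mono ξ _ _ (hroot .fromParent)
  · split_ifs with hj
    · exact upExits_le_returns h _
    · refine Nat.le_zero.2 (Nat.eq_zero_of_not_pos fun hpos => hj ?_)
      obtain ⟨l, hl⟩ := visited_of_upExits_pos hpos
      have hl : 0 < instrCount ξ ([], l) (.down j) (odometer ξ n ([], l)) := hl
      have hle := hroot l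
      split_ifs at hle with hfp
      · subst hfp
        exact instrCount_one_pos.1 (hl.trans_le (instrCount_mono ξ _ _ hle))
      · exact absurd (pos_of_instrCount_pos hl) (by omega)

open Filter in
-- Truncation only removes frogs, and each of the finitely many events counted by `returns` takes
-- place at some finite time. The root is excluded because frogs that come up to it do not continue.
theorem eventually_returns_le {ξ : Stack d} (D : ℕ) : ∀ {v : Vertex d}, v ≠ [] →
    (∀ᶠ n in atTop, Visited ξ (odometer ξ n) v) →
    ∀ᶠ n in atTop, returns ξ D v ≤ upExits ξ (odometer ξ n) v := by
  classical
  induction D with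
  | zero => exact fun _ _ => .of_forall fun n => Nat.zero_le _
  | succ D ih =>
    intro v hv hvis
    have hsucc : ∀ {p : ℕ → Prop}, (∀ᶠ n in atTop, p (n + 1)) → ∀ᶠ n in atTop, p n := by
      intro p h
      exact (Filter.eventually_atTop.1 h).elim fun N hN => Filter.eventually_atTop.2
        ⟨N + 1, fun n hn => by
          have := hN (n - 1) (by omega)
          rwa [Nat.sub_add_cancel (by omega)] at this⟩
    have h1 : ∀ᶠ n in atTop, odometer ξ n (v, .origin) = 1 ∧ odometer ξ n (v, .fromParent) = 1 := by
      refine hsucc (hvis.mono fun n hn => ?_)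
      rw [odometer_succ]
      simp [arrivals, hv, hn]
    have h2 : ∀ j, (∀ᶠ n in atTop, Visited ξ (odometer ξ n) (j :: v)) →
        ∀ᶠ n in atTop, returns ξ D (j :: v) ≤ odometer ξ n (v, .fromChild j) := by
      intro j hj
      refine hsucc ((ih (List.cons_ne_nil j v) hj).mono fun n hn => ?_)
      rw [odometer_succ]
      simpa [arrivals, hv] using hn
    -- Following the derivation of `Reach`, each child in the closure is visited after finitely many
    -- steps.
    have h3 : ∀ j, Reach (startSet ξ v) (fun j => jumpSet ξ v j (returns ξ D (j :: v))) j →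
        ∀ᶠ n in atTop, Visited ξ (odometer ξ n) (j :: v) := by
      intro j hj
      induction hj with
      | base hi =>
        refine h1.mono fun n hn => ?_
        rcases hi with hi | hi
        · refine ⟨.origin, ?_⟩
          rw [exits, hn.1]
          exact instrCount_one_pos.2 hi
        · refine ⟨.fromParent, ?_⟩
          rw [exits, hn.2]
          exact instrCount_one_pos.2 hi
      | @step i j _ hi ihj =>
        exact (h2 j ihj).mono fun n hn =>
          ⟨.fromChild j, Nat.lt_of_lt_of_le hi (instrCount_mono ξ _ _ hn)⟩
    have h4 : ∀ᶠ n in atTop, ∀ j,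
        Reach (startSet ξ v) (fun j => jumpSet ξ v j (returns ξ D (j :: v))) j →
        returns ξ D (j :: v) ≤ odometer ξ n (v, .fromChild j) := by
      refine Filter.eventually_all.2 fun j => ?_
      by_cases hj : Reach (startSet ξ v) (fun j => jumpSet ξ v j (returns ξ D (j :: v))) j
      · exact (h2 j (h3 j hj)).mono fun n hn _ => hn
      · exact .of_forall fun n h => absurd h hj
    filter_upwards [h1, h4] with n hn1 hn4
    rw [upExits_eq, returns, hn1.1, hn1.2]
    refine add_le_add le_rfl (Finset.sum_le_sum fun j _ => ?_)
    split_ifs with hj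
    · exact instrCount_mono ξ _ _ (hn4 j hj)
    · exact Nat.zero_le _

open Filter in
theorem eventually_rootReturns_le (ξ : Stack d) (D : ℕ) :
    ∀ᶠ n in atTop, rootReturns ξ D ≤ rootExits ξ (odometer ξ n) := by
  classical
  have h1 : ∀ᶠ n in atTop, odometer ξ n ([], .fromParent) = 1 := by
    refine Filter.eventually_atTop.2 ⟨1, fun n hn => ?_⟩
    rw [← Nat.sub_add_cancel hn, odometer_succ]
    simp [arrivals, Visited]
  have h2 : ∀ᶠ n in atTop, ∀ j, ξ (([], .fromParent), 0) = .down j →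
      returns ξ D [j] ≤ upExits ξ (odometer ξ n) [j] := by
    refine Filter.eventually_all.2 fun j => ?_
    by_cases hj : ξ (([], .fromParent), 0) = .down j
    · refine (eventually_returns_le D (List.cons_ne_nil j [])
        (h1.mono fun n hn => ⟨.fromParent, ?_⟩)).mono fun n hn _ => hn
      rw [exits, hn]
      exact instrCount_one_pos.2 hj
    · exact .of_forall fun n h => absurd h hj
  filter_upwards [h1, h2] with n hn1 hn2
  rw [rootReturns, rootExits, upExits_eq, hn1]
  refine add_le_add (by omega) (Finset.sum_le_sum fun j _ => ?_)
  split_ifs with hj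
  · exact hn2 j hj
  · exact Nat.zero_le _

end

section

/-! ### Closed sets and the recursion for the polynomials -/

section Closure

variable {κ : Type*}

theorem Reach.mono_of_agree {I : Set κ} {D D' : κ → Set κ} {S : Set κ}
    (hS : ∀ i, Reach I D i → i ∈ S) (h : ∀ j ∈ S, D j = D' j) {i : κ} (hi : Reach I D i) :
    Reach I D' i := by
  induction hi with
  | base hi => exact .base hi
  | @step i j hj hi ih => exact .step ih (h j (hS j hj) ▸ hi)

/-- Whether the closure equals `S` is decided by the jumps out of `S` alone. This makes that event
independent of the data of the children outside `S`. -/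
theorem reach_congr {I : Set κ} {D D' : κ → Set κ} {S : Set κ}
    (hS : ∀ i, Reach I D i ↔ i ∈ S) (h : ∀ j ∈ S, D j = D' j) (i : κ) :
    Reach I D' i ↔ i ∈ S := by
  constructor
  · intro hi
    induction hi with
    | base hi => exact (hS _).1 (.base hi)
    | @step i j hj hi ih => exact (hS _).1 (.step ((hS j).2 ih) ((h j ih).symm ▸ hi))
  · exact fun hi => Reach.mono_of_agree (fun i hi => (hS i).1 hi) h ((hS i).2 hi)

theorem mem_of_reach {I : Set κ} {D : κ → Set κ} {S : Set κ} (hI : I ⊆ S)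
    (h : ∀ j ∈ S, D j ⊆ S) {i : κ} (hi : Reach I D i) : i ∈ S := by
  induction hi with
  | base hi => exact hI hi
  | @step i j hj hi ih => exact h j ih hi

variable [Fintype κ]

open Classical in
/-- The closure of `I` under the relations `j → i` for `i ∈ D j`, as a finite set. -/
def reachFinset (I : Finset κ) (D : κ → Set κ) : Finset κ :=
  Finset.univ.filter (Reach I D)

theorem mem_reachFinset {I : Finset κ} {D : κ → Set κ} {i : κ} :
    i ∈ reachFinset I D ↔ Reach I D i := by
  simp [reachFinset]

theorem subset_reachFinset (I : Finset κ) (D : κ → Set κ) : I ⊆ reachFinset I D :=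
  fun _ hi => mem_reachFinset.2 (.base hi)

theorem reachFinset_congr {I S : Finset κ} {D D' : κ → Set κ} (hS : reachFinset I D = S)
    (h : ∀ j ∈ S, D j = D' j) : reachFinset I D' = S := by
  ext i
  rw [mem_reachFinset, reach_congr (S := S) (D := D) (fun i => by rw [← hS]; simp [mem_reachFinset]) h,
    Finset.mem_coe]

open Classical in
/-- The weight of the event that the closure of `I` is `S`. -/
def closureWeight (x : ℝ) (I S : Finset κ) (f : κ → ℕ × Set κ) : ℝ :=
  if reachFinset I (fun j => (f j).2) = S then ∏ j ∈ S, x ^ (f j).1 else 0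

theorem closureWeight_congr (x : ℝ) {I S : Finset κ} {f f' : κ → ℕ × Set κ}
    (h : ∀ j ∈ S, f j = f' j) : closureWeight x I S f = closureWeight x I S f' := by
  unfold closureWeight
  have h1 : reachFinset I (fun j => (f j).2) = S ↔ reachFinset I (fun j => (f' j).2) = S :=
    ⟨fun hS => reachFinset_congr hS fun j hj => by rw [h j hj],
      fun hS => reachFinset_congr hS fun j hj => by rw [h j hj]⟩
  have h2 : ∏ j ∈ S, x ^ (f j).1 = ∏ j ∈ S, x ^ (f' j).1 :=
    Finset.prod_congr rfl fun j hj => by rw [h j hj]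
  by_cases h3 : reachFinset I (fun j => (f j).2) = S
  · rw [if_pos h3, if_pos (h1.1 h3), h2]
  · rw [if_neg h3, if_neg (mt h1.2 h3)]

theorem closureWeight_eq_zero (x : ℝ) {I S : Finset κ} (h : ¬ I ⊆ S) (f : κ → ℕ × Set κ) :
    closureWeight x I S f = 0 := by
  rw [closureWeight, if_neg]
  rintro rfl
  exact h (subset_reachFinset _ _)

theorem sum_closureWeight (x : ℝ) (I : Finset κ) (f : κ → ℕ × Set κ) :
    ∑ S, closureWeight x I S f = ∏ j ∈ reachFinset I (fun j => (f j).2), x ^ (f j).1 := by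
  classical
  simp [closureWeight]

open Classical in
/-- The weight of the event that all jumps from below `j` stay in `S`. -/
def stayWeight (x : ℝ) (S : Finset κ) (a : ℕ × Set κ) : ℝ :=
  if a.2 ⊆ S then x ^ a.1 else 0

/-- If all jumps from `S` stay in `S`, then the closure S' of `I` lies in `S`, and exactly one term
survives. Its condition on the children in S' is automatic, since S' is closed; the other children
in `S` keep their factors. -/
theorem prod_stayWeight [DecidableEq κ] (x : ℝ) {I S : Finset κ} (hI : I ⊆ S) (f : κ → ℕ × Set κ) :
    ∏ j ∈ S, stayWeight x S (f j) =
      ∑ S' ∈ Finset.Icc I S, closureWeight x I S' f * ∏ j ∈ S \ S', stayWeight x S (f j) := by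
  by_cases h : ∀ j ∈ S, (f j).2 ⊆ S
  · have hmem : reachFinset I (fun j => (f j).2) ∈ Finset.Icc I S :=
      Finset.mem_Icc.2 ⟨subset_reachFinset _ _, fun i hi =>
        mem_of_reach (Finset.coe_subset.2 hI) h (mem_reachFinset.1 hi)⟩
    rw [Finset.sum_eq_single_of_mem _ hmem fun S' _ hS' => by
      rw [closureWeight, if_neg (Ne.symm hS'), zero_mul]]
    rw [closureWeight, if_pos rfl, ← Finset.prod_sdiff (Finset.mem_Icc.1 hmem).2, mul_comm]
    congr 1
    refine Finset.prod_congr rfl fun j hj => ?_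
    rw [stayWeight, if_pos (h j ((Finset.mem_Icc.1 hmem).2 hj))]
  · push Not at h
    obtain ⟨j, hj, hjS⟩ := h
    rw [Finset.prod_eq_zero hj (by rw [stayWeight, if_neg hjS]), eq_comm]
    refine Finset.sum_eq_zero fun S' hS' => ?_
    by_cases hr : reachFinset I (fun j => (f j).2) = S'
    · rw [Finset.prod_eq_zero (i := j), mul_zero]
      -- Were `j` in the closure S', its jumps would stay in S', hence in `S`.
      · refine Finset.mem_sdiff.2 ⟨hj, fun hjS' => hjS fun i hi => ?_⟩
        refine (Finset.mem_Icc.1 hS').2 ?_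
        rw [← hr, mem_reachFinset] at hjS' ⊢
        exact .step hjS' hi
      · rw [stayWeight, if_neg hjS]
    · rw [closureWeight, if_neg hr, zero_mul]

end Closure

/-! ### Inclusion-exclusion and the recursions for `P` and `Q` -/

theorem sum_Icc_card {κ M : Type*} [DecidableEq κ] [AddCommMonoid M] (F : ℕ → M) {I S : Finset κ} (h : I ⊆ S) :
    ∑ S' ∈ Finset.Icc I S, F S'.card =
      ∑ m ∈ Finset.range (S.card - I.card + 1),
        (S.card - I.card).choose m • F (I.card + m) := by
  rw [Finset.Icc_eq_image_powerset h, Finset.sum_image, ← Finset.card_sdiff_of_subset h,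
    ← Finset.sum_powerset_apply_card fun m => F (I.card + m)]
  · refine Finset.sum_congr rfl fun T hT => ?_
    rw [Finset.card_union_of_disjoint]
    exact Finset.disjoint_of_subset_right (Finset.mem_powerset.1 hT) Finset.disjoint_sdiff
  · intro T hT T' hT' hTT'
    have h1 : ∀ T ∈ (S \ I).powerset, (I ∪ T) \ I = T := fun T hT => by
      rw [Finset.union_sdiff_left, Finset.sdiff_eq_self_of_disjoint]
      exact (Finset.disjoint_of_subset_right (Finset.mem_powerset.1 hT) Finset.disjoint_sdiff).symm
    rw [← h1 T hT, ← h1 T' hT']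
    exact congrArg (· \ I) hTT'

/-- Inclusion-exclusion over closed sets. -/
theorem eq_of_closure_recursion {κ : Type*} [DecidableEq κ] (z R : ℕ → ℝ) (I : Finset κ) (W : Finset κ → ℝ)
    (hR : ∀ m, R m = z (I.card + m) ^ (I.card + m) -
      ∑ t ∈ Finset.range m, (m.choose t : ℝ) * z (I.card + m) ^ (m - t) * R t)
    (hW : ∀ S, I ⊆ S → z S.card ^ S.card =
      ∑ S' ∈ Finset.Icc I S, W S' * z S.card ^ (S.card - S'.card))
    (S : Finset κ) (hS : I ⊆ S) : W S = R (S.card - I.card) := by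
  induction S using Finset.strongInduction with
  | H S ih =>
    have hcard := Finset.card_le_card hS
    have h1 := hW S hS
    have hmem : S ∈ Finset.Icc I S := Finset.mem_Icc.2 ⟨hS, subset_rfl⟩
    rw [← Finset.add_sum_erase _ _ hmem, Nat.sub_self, pow_zero, mul_one] at h1
    -- The term for S itself has coefficient 1, so the system is triangular. By induction the other
    -- terms depend on cardinalities only, which allows grouping them by size.
    have h2 : ∑ S' ∈ (Finset.Icc I S).erase S, W S' * z S.card ^ (S.card - S'.card) =
        ∑ S' ∈ (Finset.Icc I S).erase S,
          R (S'.card - I.card) * z S.card ^ (S.card - S'.card) := by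
      refine Finset.sum_congr rfl fun S' hS' => ?_
      obtain ⟨hne, hS'⟩ := Finset.mem_erase.1 hS'
      obtain ⟨hI, hS'⟩ := Finset.mem_Icc.1 hS'
      rw [ih S' (hS'.ssubset_of_ne hne) hI]
    have h3 := sum_Icc_card (fun l => R (l - I.card) * z S.card ^ (S.card - l)) hS
    rw [← Finset.add_sum_erase _ _ hmem, Finset.sum_range_succ] at h3
    simp only [Nat.sub_self, pow_zero, mul_one, Nat.choose_self, one_smul,
      Nat.add_sub_cancel' hcard, nsmul_eq_mul, Nat.add_sub_cancel_left] at h3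
    rw [hR, Nat.add_sub_cancel' hcard]
    have h4 : ∑ m ∈ Finset.range (S.card - I.card),
        ((S.card - I.card).choose m : ℝ) * (R m * z S.card ^ (S.card - (I.card + m))) =
        ∑ t ∈ Finset.range (S.card - I.card),
          ((S.card - I.card).choose t : ℝ) * z S.card ^ (S.card - I.card - t) * R t := by
      refine Finset.sum_congr rfl fun m _ => ?_
      rw [Nat.sub_add_eq]
      ring
    linarith

theorem sum_Icc_eq_sum_range {M : Type*} [AddCommMonoid M] (F : ℕ → M) (a c : ℕ) :
    ∑ l ∈ Finset.Icc a c, F l = ∑ t ∈ Finset.range (c + 1 - a), F (a + t) := by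
  rw [← Finset.sum_Ico_eq_sum_range]
  rfl

/-- The index shift l = 1 + t brings the definition into the form of `eq_of_closure_recursion` with
`I.card = 1`; the order `1 + m` matches `I.card + m`. -/
theorem eval_P_succ (z : ℕ → ℝ) (m : ℕ) :
    MvPolynomial.eval z (P (m + 1)) = z (1 + m) ^ (1 + m) -
      ∑ t ∈ Finset.range m, (m.choose t : ℝ) * z (1 + m) ^ (m - t) *
        MvPolynomial.eval z (P (t + 1)) := by
  rw [P, Finset.sum_attach (Finset.Icc 1 m) fun l => (m.choose (l - 1) : MvPolynomial ℕ ℝ) *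
    MvPolynomial.X (m + 1) ^ (m + 1 - l) * P l, sum_Icc_eq_sum_range]
  simp only [map_sub, map_pow, map_sum, map_mul, map_natCast, MvPolynomial.eval_X]
  refine congrArg₂ _ (by rw [add_comm]) (Finset.sum_congr rfl fun t _ => ?_)
  rw [show m + 1 - (1 + t) = m - t by omega, show 1 + t - 1 = t by omega, add_comm m, add_comm t]

theorem eval_Q_succ (z : ℕ → ℝ) (m : ℕ) :
    MvPolynomial.eval z (Q (m + 2)) = z (2 + m) ^ (2 + m) -
      ∑ t ∈ Finset.range m, (m.choose t : ℝ) * z (2 + m) ^ (m - t) *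
        MvPolynomial.eval z (Q (t + 2)) := by
  rw [Q, Finset.sum_attach (Finset.Icc 2 (m + 1)) fun l => (m.choose (l - 2) : MvPolynomial ℕ ℝ) *
    MvPolynomial.X (m + 2) ^ (m + 2 - l) * Q l, sum_Icc_eq_sum_range]
  simp only [map_sub, map_pow, map_sum, map_mul, map_natCast, MvPolynomial.eval_X]
  rw [show m + 1 + 1 - 2 = m by omega]
  refine congrArg₂ _ (by rw [add_comm]) (Finset.sum_congr rfl fun t _ => ?_)
  rw [show m + 2 - (2 + t) = m - t by omega, show 2 + t - 2 = t by omega, add_comm m, add_comm t]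

end

section

/-- A coordinate can be integrated out last. -/
theorem integral_eval_bind {ι α : Type*} [MeasurableSpace α] [MeasurableSingletonClass α] [Finite α]
    (μ : ι → Measure α) [∀ i, IsProbabilityMeasure (μ i)] {i : ι} {T : Set ι}
    {f : α → (ι → α) → ℝ} (hf : ∀ a, IsCylinder (f a) T) (hi : i ∉ T) :
    ∫ ω, f (ω i) ω ∂Measure.infinitePi μ = ∫ a, ∫ ω, f a ω ∂Measure.infinitePi μ ∂μ i := by
  classical
  have hc : IsCylinder (fun ω : ι → α => f (ω i) ω) Set.univ :=
    IsCylinder.bind (isCylinder_eval (Set.mem_univ i)) fun ω => (hf _).mono (Set.subset_univ T)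
  rw [integral_resample μ hc {i},
    ← integral_eval μ i fun a => ∫ ω, f a ω ∂Measure.infinitePi μ]
  congr! 4 with ω' ω
  refine (congrArg (fun a => f a _)
    (Set.piecewise_eq_of_mem _ _ _ (Set.mem_singleton i))).trans ?_
  refine (hf _).dependsOn fun k hk => ?_
  rw [Set.piecewise_eq_of_notMem]
  rintro rfl
  exact hi hk

variable {d : ℕ} {p : ℝ}

theorem stepProb_nonneg (hd : 2 ≤ d) (hp0 : 0 ≤ p) (hp1 : p ≤ 1) (l : LastStep d) (m : Move d) :
    0 ≤ stepProb d p l m := by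
  have hd' : (2 : ℝ) ≤ d := by exact_mod_cast hd
  have hq : 0 ≤ 1 - p := by linarith
  have hd1 : (0 : ℝ) ≤ d - 1 := by linarith
  rcases l with _ | j | _ <;> rcases m with _ | i <;> simp only [stepProb]
  · exact hp0
  · positivity
  · positivity
  · split_ifs <;> positivity
  · exact le_rfl
  · positivity

theorem integral_stepLaw (hd : 2 ≤ d) (hp0 : 0 ≤ p) (hp1 : p ≤ 1) (l : LastStep d)
    (f : Move d → ℝ) : ∫ m, f m ∂stepLaw d p l = ∑ m, stepProb d p l m * f m := by
  rw [stepLaw, integral_finsetSum_measure fun m _ =>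
    (integrable_dirac (by finiteness)).smul_measure ENNReal.ofReal_ne_top]
  refine Finset.sum_congr rfl fun m _ => ?_
  rw [integral_smul_measure, integral_dirac, ENNReal.toReal_ofReal (stepProb_nonneg hd hp0 hp1 l m),
    smul_eq_mul]

theorem sum_move {M : Type*} [AddCommMonoid M] (f : Move d → M) :
    ∑ m, f m = f .up + ∑ i, f (.down i) := by
  let e : Option (Fin d) ≃ Move d :=
    { toFun := fun o => o.elim .up .down
      invFun := fun m => match m with
        | .up => none
        | .down i => some i
      left_inv := by rintro (_ | i) <;> rfl
      right_inv := by rintro (_ | i) <;> rfl }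
  rw [← e.sum_comp, Fintype.sum_option]
  rfl

/-! ### The data of the children of a vertex -/

/-- The weight of a step from a child of a vertex: `x` for a step up, and the indicator of `S` for
a step down. -/
def moveWeight (x : ℝ) (S : Finset (Fin d)) : Move d → ℝ
  | .up => x
  | .down i => if i ∈ S then 1 else 0

/-- The numbers of upward jumps among `n` instructions and the set of chosen children. -/
def instrData (ξ : Stack d) (x : Place d) (n : ℕ) : ℕ × Set (Fin d) :=
  (instrCount ξ x .up n, {i | 0 < instrCount ξ x (.down i) n})

/-- As a product over single instructions, the weight has an expectation that factors by
independence. -/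
theorem stayWeight_instrData (ξ : Stack d) (x : Place d) (y : ℝ) (S : Finset (Fin d)) (n : ℕ) :
    stayWeight y S (instrData ξ x n) = ∏ k ∈ Finset.range n, moveWeight y S (ξ (x, k)) := by
  induction n with
  | zero => simp [stayWeight, instrData]
  | succ n ih =>
    rw [Finset.prod_range_succ, ← ih]
    rcases hm : ξ (x, n) with _ | i
    · have h1 : ∀ i, instrCount ξ x (.down i) (n + 1) = instrCount ξ x (.down i) n := fun i => by
        simp [instrCount, Nat.count_succ, hm]
      have h2 : instrCount ξ x .up (n + 1) = instrCount ξ x .up n + 1 := by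
        simp [instrCount, Nat.count_succ, hm]
      have h3 : instrData ξ x (n + 1) = (instrCount ξ x .up n + 1, (instrData ξ x n).2) := by
        simp only [instrData, h1, h2]
      rw [h3]
      by_cases h : (instrData ξ x n).2 ⊆ S
      · rw [stayWeight, if_pos h, stayWeight, if_pos h]
        exact pow_succ _ _
      · rw [stayWeight, if_neg h, stayWeight, if_neg h, zero_mul]
    · have h1 : ∀ i', 0 < instrCount ξ x (.down i') (n + 1) ↔
          0 < instrCount ξ x (.down i') n ∨ i' = i := fun i' => by
        by_cases h : i = i' <;> simp [instrCount, Nat.count_succ, hm, h, eq_comm]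
      have h2 : instrCount ξ x .up (n + 1) = instrCount ξ x .up n := by
        simp [instrCount, Nat.count_succ, hm]
      have h3 : (instrData ξ x (n + 1)).2 ⊆ S ↔ (instrData ξ x n).2 ⊆ S ∧ i ∈ S := by
        simp only [instrData, h1, Set.ofPred_or, Set.union_subset_iff]
        simp
      have h4 : (instrData ξ x (n + 1)).1 = (instrData ξ x n).1 := h2
      by_cases h : (instrData ξ x n).2 ⊆ S
      · by_cases hi : i ∈ S
        · rw [stayWeight, if_pos (h3.2 ⟨h, hi⟩), stayWeight, if_pos h, h4]
          simp [moveWeight, hi]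
        · rw [stayWeight, if_neg fun h' => hi (h3.1 h').2]
          simp [moveWeight, hi]
      · rw [stayWeight, if_neg fun h' => h (h3.1 h').1, stayWeight, if_neg h, zero_mul]

/-- What is seen at `v` of the frogs that enter the `j`-th child of `v`. -/
def childData (ξ : Stack d) (D : ℕ) (v : Vertex d) (j : Fin d) : ℕ × Set (Fin d) :=
  instrData ξ (v, .fromChild j) (returns ξ D (j :: v))

/-- The stack entries at the descendants of `v`. -/
def below (v : Vertex d) : Set (Place d × ℕ) := {q | v <:+ q.1.1}

/-- The stack entries of the frogs that come up to `v` from the `j`-th child of `v`. -/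
def upStack (v : Vertex d) (j : Fin d) : Set (Place d × ℕ) := {q | q.1 = (v, .fromChild j)}

/-- The stack entries that determine `childData`. -/
def childRegion (v : Vertex d) (j : Fin d) : Set (Place d × ℕ) := below (j :: v) ∪ upStack v j

theorem not_suffix_cons {j : Fin d} {v : Vertex d} : ¬ (j :: v) <:+ v := fun h => by
  have := h.length_le
  simp at this

theorem disjoint_below_upStack (v : Vertex d) (j j' : Fin d) :
    Disjoint (below (j :: v)) (upStack v j') :=
  Set.disjoint_left.2 fun q hq hq' => by
    rw [upStack, Set.mem_ofPred_eq] at hq'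
    rw [below, Set.mem_ofPred_eq, hq'] at hq
    exact not_suffix_cons hq

/-- The source of independence between siblings: the returns of a child use stacks in its own
subtree, and the returning frogs use a stack at `v` labelled by that child. -/
theorem disjoint_childRegion (v : Vertex d) {j j' : Fin d} (h : j ≠ j') :
    Disjoint (childRegion v j) (childRegion v j') := by
  rw [childRegion, childRegion, Set.disjoint_union_left, Set.disjoint_union_right,
    Set.disjoint_union_right]
  refine ⟨⟨Set.disjoint_left.2 fun q hq hq' => h ?_, disjoint_below_upStack v j j'⟩,
    (disjoint_below_upStack v j' j).symm, Set.disjoint_left.2 fun q hq hq' => h ?_⟩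
  · have := List.IsSuffix.eq_of_length (List.suffix_of_suffix_length_le hq hq' (by simp)) (by simp)
    exact (List.cons.inj this).1
  · have : (v, LastStep.fromChild j) = (v, .fromChild j') :=
      (show q.1 = _ from hq).symm.trans hq'
    simpa using this

theorem childRegion_subset_below (v : Vertex d) (j : Fin d) : childRegion v j ⊆ below v := by
  rintro q (hq | hq)
  · exact (List.suffix_cons j v).trans hq
  · rw [upStack, Set.mem_ofPred_eq] at hq
    rw [below, Set.mem_ofPred_eq, hq]

theorem isCylinder_instrCount (x : Place d) (m : Move d) (n : ℕ) :
    IsCylinder (fun ξ => instrCount ξ x m n) {q | q.1 = x} := by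
  classical
  have h := isCylinder_finset_sum (s := Finset.range n) (T := {q : Place d × ℕ | q.1 = x})
    (f := fun k (ξ : Stack d) => if ξ (x, k) = m then 1 else 0) fun k _ =>
    (isCylinder_eval (i := (x, k)) (T := {q : Place d × ℕ | q.1 = x}) rfl).comp
      fun a => if a = m then 1 else 0
  simp only [instrCount, Nat.count_eq_card_filter_range, Finset.card_filter]
  exact h

theorem isCylinder_instrData (x : Place d) (n : ℕ) :
    IsCylinder (fun ξ => instrData ξ x n) {q | q.1 = x} :=
  (isCylinder_instrCount x .up n).comp₂
    (isCylinder_pi fun i => isCylinder_instrCount x (.down i) n) fun a f => (a, {i | 0 < f i})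

theorem isCylinder_childData_of {D : ℕ}
    (h : ∀ v : Vertex d, IsCylinder (fun ξ => returns ξ D v) (below v)) (v : Vertex d) (j : Fin d) :
    IsCylinder (fun ξ => childData ξ D v j) (childRegion v j) :=
  IsCylinder.bind (f := fun n ξ => instrData ξ (v, .fromChild j) n)
    ((h (j :: v)).mono Set.subset_union_left)
    fun _ => (isCylinder_instrData _ _).mono Set.subset_union_right

/-- The children of a vertex that are entered by its first two frogs. -/
def startFinset (a b : Move d) : Finset (Fin d) :=
  Finset.univ.filter fun i => a = .down i ∨ b = .down i

theorem returns_succ (ξ : Stack d) (D : ℕ) (v : Vertex d) :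
    returns ξ (D + 1) v = (if ξ ((v, .origin), 0) = .up then 1 else 0) +
      (if ξ ((v, .fromParent), 0) = .up then 1 else 0) +
      ∑ j ∈ reachFinset (startFinset (ξ ((v, .origin), 0)) (ξ ((v, .fromParent), 0)))
        (fun j => (childData ξ D v j).2), (childData ξ D v j).1 := by
  classical
  have h1 : ∀ x, instrCount ξ x .up 1 = if ξ (x, 0) = .up then 1 else 0 := fun x => by
    simp [instrCount, Nat.count_succ]
  have h2 : (startFinset (ξ ((v, .origin), 0)) (ξ ((v, .fromParent), 0)) : Set (Fin d)) =
      startSet ξ v := by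
    ext i
    simp [startFinset, startSet]
  rw [returns, h1, h1, reachFinset, h2, Finset.sum_filter]
  rfl

theorem isCylinder_returns (D : ℕ) :
    ∀ v : Vertex d, IsCylinder (fun ξ => returns ξ D v) (below v) := by
  classical
  induction D with
  | zero => exact fun v => isCylinder_const _ _
  | succ D ih =>
    intro v
    simp only [returns_succ]
    have h1 := isCylinder_eval (α := Move d) (T := below v) (i := ((v, .origin), 0))
      (List.suffix_refl v)
    have h2 := isCylinder_eval (α := Move d) (T := below v) (i := ((v, .fromParent), 0))
      (List.suffix_refl v)
    exact ((h1.prodMk h2).prodMk (isCylinder_pi fun j =>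
      (isCylinder_childData_of ih v j).mono (childRegion_subset_below v j))).comp
      fun z => (if z.1.1 = .up then 1 else 0) + (if z.1.2 = .up then 1 else 0) +
        ∑ j ∈ reachFinset (startFinset z.1.1 z.1.2) (fun j => (z.2 j).2), (z.2 j).1

theorem isCylinder_childData (D : ℕ) (v : Vertex d) (j : Fin d) :
    IsCylinder (fun ξ => childData ξ D v j) (childRegion v j) :=
  isCylinder_childData_of (isCylinder_returns D) v j

/-- The product of a random number of independent factors. -/
theorem integral_random_prod {ι α : Type*} [MeasurableSpace α] [MeasurableSingletonClass α]
    [Finite α] (μ : ι → Measure α) [∀ i, IsProbabilityMeasure (μ i)] {N : (ι → α) → ℕ} {T : Set ι}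
    (hN : IsCylinder N T) {q : ℕ → ι} (hq : Function.Injective q) (hT : ∀ k, q k ∉ T) (f : α → ℝ)
    {y : ℝ} (hf : ∀ k, ∫ a, f a ∂μ (q k) = y) :
    ∫ ω, ∏ k ∈ Finset.range (N ω), f (ω (q k)) ∂Measure.infinitePi μ =
      ∫ ω, y ^ N ω ∂Measure.infinitePi μ := by
  classical
  obtain ⟨B, hB⟩ := hN.finite_range.bddAbove
  -- Decompose by the value of `N`, which is bounded as a cylinder function; for a fixed value the
  -- number of factors is deterministic.
  have hsum : ∀ (F : ℕ → ℝ) ω, F (N ω) =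
      ∑ n ∈ Finset.range (B + 1), (if N ω = n then 1 else 0) * F n := by
    intro F ω
    have : N ω ∈ Finset.range (B + 1) := Finset.mem_range.2 (Nat.lt_succ_of_le (hB ⟨ω, rfl⟩))
    simp [this]
  have hc : ∀ n, IsCylinder (fun ω => if N ω = n then (1 : ℝ) else 0) T := fun n =>
    hN.comp fun a => if a = n then 1 else 0
  have hp : ∀ n, IsCylinder (fun ω : ι → α => ∏ k ∈ Finset.range n, f (ω (q k)))
      (Set.range q) := fun n => isCylinder_finset_prod fun k _ =>
        (isCylinder_eval (Set.mem_range_self k)).comp f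
  have hdis : Disjoint T (Set.range q) := Set.disjoint_right.2 fun _ ⟨k, hk⟩ => hk ▸ hT k
  rw [integral_congr_ae (.of_forall fun ω =>
    hsum (fun n => ∏ k ∈ Finset.range n, f (ω (q k))) ω),
    integral_congr_ae (.of_forall fun ω => hsum (fun n => y ^ n) ω),
    integral_finsetSum _ fun n _ => (((hc n).mono (Set.subset_univ T)).comp₂
      ((hp n).mono (Set.subset_univ _)) (· * ·)).integrable _,
    integral_finsetSum _ fun n _ => ((hc n).integrable _).mul_const _]
  refine Finset.sum_congr rfl fun n _ => ?_
  rw [integral_mul_of_disjoint μ (hc n) (hp n) hdis, integral_mul_const,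
    integral_prod_of_disjoint μ (Finset.range n) (T := fun k => {q k})
      (fun k _ => (isCylinder_eval (Set.mem_singleton _)).comp f)
      fun k _ k' _ h => Set.disjoint_singleton.2 (hq.ne h)]
  simp [integral_eval, hf]

end

section

variable {d : ℕ} {p : ℝ}

/-! ### The recursion for the law of the number of returns -/

/-- A frog that came up from `j` cannot step back to `j`, so `S.card - 1` children in `S` are open
to it. This is why the index of `c` is one less than the size. -/
theorem integral_moveWeight (hd : 2 ≤ d) (hp0 : 0 ≤ p) (hp1 : p ≤ 1) (x : ℝ) {S : Finset (Fin d)}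
    {j : Fin d} (hj : j ∈ S) :
    ∫ m, moveWeight x S m ∂stepLaw d p (.fromChild j) = c d p (S.card - 1) x := by
  rw [integral_stepLaw hd hp0 hp1, sum_move]
  have h : ∀ i, stepProb d p (.fromChild j) (.down i) * moveWeight x S (.down i) =
      if i ∈ S.erase j then (1 - p) / d / (p + (1 - p) * (d - 1) / d) else 0 := by
    intro i
    by_cases h1 : i = j <;> by_cases h2 : i ∈ S <;> simp [stepProb, moveWeight, h1, h2]
  simp only [h, Finset.sum_ite_mem, Finset.univ_inter, Finset.sum_const, Finset.card_erase_of_mem hj,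
    nsmul_eq_mul]
  simp only [stepProb, moveWeight, c]
  ring

section

variable [∀ l, IsProbabilityMeasure (stepLaw d p l)]

/-- Given the number of returns from `j`, the instructions of the returning frogs are independent
with mean weight c^{(|S|-1)}(x). This is where the composition operators `Z` come from. -/
theorem integral_stayWeight (hd : 2 ≤ d) (hp0 : 0 ≤ p) (hp1 : p ≤ 1) (x : ℝ) (D : ℕ)
    (v : Vertex d) {S : Finset (Fin d)} {j : Fin d} (hj : j ∈ S) :
    ∫ ξ, stayWeight x S (childData ξ D v j) ∂stackLaw d p =
      ∫ ξ, c d p (S.card - 1) x ^ returns ξ D (j :: v) ∂stackLaw d p := by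
  simp only [childData, stayWeight_instrData]
  exact integral_random_prod _ (isCylinder_returns D (j :: v))
    (q := fun k => ((v, .fromChild j), k)) (fun k k' h => by simpa using h)
    (fun k h => not_suffix_cons h) _ fun k => integral_moveWeight hd hp0 hp1 x hj

/-- The weight of the event that `S` is the set of visited children of `v`. -/
def closureProb (p : ℝ) (x : ℝ) (D : ℕ) (v : Vertex d) (I S : Finset (Fin d)) : ℝ :=
  ∫ ξ, closureWeight x I S (childData ξ D v) ∂stackLaw d p

theorem isCylinder_closureWeight (x : ℝ) (D : ℕ) (v : Vertex d) (I S : Finset (Fin d)) :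
    IsCylinder (fun ξ => closureWeight x I S (childData ξ D v)) (⋃ j ∈ S, childRegion v j) := by
  classical
  have h : IsCylinder (fun (ξ : Stack d) (j : Fin d) =>
      if j ∈ S then childData ξ D v j else (0, ∅)) (⋃ j ∈ S, childRegion v j) := by
    -- Data outside `S` can be replaced by a dummy value, by `closureWeight_congr`.
    refine isCylinder_pi fun j => ?_
    by_cases hj : j ∈ S
    · simp only [if_pos hj]
      exact (isCylinder_childData D v j).mono
        (Set.subset_biUnion_of_mem (u := fun j => childRegion v j) hj)
    · simp only [if_neg hj]
      exact isCylinder_const _ _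
  have h2 := h.comp (closureWeight x I S)
  have h3 : ∀ ξ : Stack d, closureWeight x I S (fun j : Fin d =>
      if j ∈ S then childData ξ D v j else (0, ∅)) = closureWeight x I S (childData ξ D v) :=
    fun ξ => closureWeight_congr x fun j hj => if_pos hj
  simpa only [h3] using h2

theorem isCylinder_stayWeight (x : ℝ) (D : ℕ) (v : Vertex d) (S : Finset (Fin d)) (j : Fin d) :
    IsCylinder (fun ξ => stayWeight x S (childData ξ D v j)) (childRegion v j) :=
  (isCylinder_childData D v j).comp _

/-- The expectation of `prod_stayWeight`: the weight of the closure S' lives on the regions of S',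
the remaining factors on the disjoint regions of S \ S'. -/
theorem prod_integral_stayWeight (x : ℝ) (D : ℕ) (v : Vertex d) {I S : Finset (Fin d)}
    (hI : I ⊆ S) :
    ∏ j ∈ S, ∫ ξ, stayWeight x S (childData ξ D v j) ∂stackLaw d p =
      ∑ S' ∈ Finset.Icc I S, closureProb p x D v I S' *
        ∏ j ∈ S \ S', ∫ ξ, stayWeight x S (childData ξ D v j) ∂stackLaw d p := by
  classical
  have hdis : ∀ T : Finset (Fin d), (T : Set (Fin d)).PairwiseDisjoint (childRegion v) :=
    fun T j _ j' _ h => disjoint_childRegion v h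
  have hprod : ∀ T : Finset (Fin d),
      ∏ j ∈ T, ∫ ξ, stayWeight x S (childData ξ D v j) ∂stackLaw d p =
        ∫ ξ, ∏ j ∈ T, stayWeight x S (childData ξ D v j) ∂stackLaw d p := fun T =>
    (integral_prod_of_disjoint _ T (fun j _ => isCylinder_stayWeight x D v S j) (hdis T)).symm
  have hcyl : ∀ T : Finset (Fin d), IsCylinder
      (fun ξ => ∏ j ∈ T, stayWeight x S (childData ξ D v j)) (⋃ j ∈ T, childRegion v j) := fun T =>
    isCylinder_finset_prod fun j hj => (isCylinder_stayWeight x D v S j).mono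
      (Set.subset_biUnion_of_mem (u := fun j => childRegion v j) hj)
  simp only [hprod]
  have hlaw : IsProbabilityMeasure (stackLaw d p) := by unfold stackLaw; infer_instance
  rw [integral_congr_ae (.of_forall fun ξ => prod_stayWeight x hI (childData ξ D v)),
    integral_finsetSum (Finset.Icc I S) fun S' _ => (((isCylinder_closureWeight x D v I S').mono
      (Set.subset_univ _)).comp₂ ((hcyl (S \ S')).mono (Set.subset_univ _)) (· * ·)).integrable _]
  refine Finset.sum_congr rfl fun S' _ => ?_
  refine integral_mul_of_disjoint _ (isCylinder_closureWeight x D v I S') (hcyl (S \ S')) ?_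
  simp only [Set.disjoint_iUnion_left, Set.disjoint_iUnion_right]
  intro j hj j' hj'
  refine disjoint_childRegion v ?_
  rintro rfl
  exact (Finset.mem_sdiff.1 hj).2 hj'

/-- `h` is the generating function of the number of returns to the parent of every vertex. -/
def IsReturnGen (d : ℕ) (p : ℝ) (D : ℕ) (h : ℝ → ℝ) : Prop :=
  ∀ (v : Vertex d) x, ∫ ξ, x ^ returns ξ D v ∂stackLaw d p = h x

/-- By `integral_stayWeight`, each stay factor for `S` has expectation `Z d p S.card h x`, so
`prod_integral_stayWeight` is the hypothesis of `eq_of_closure_recursion`. -/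
theorem closureProb_eq (hd : 2 ≤ d) (hp0 : 0 ≤ p) (hp1 : p ≤ 1) {D : ℕ} {h : ℝ → ℝ}
    (hh : IsReturnGen d p D h) (x : ℝ) (v : Vertex d) {I S : Finset (Fin d)} (hI : I ⊆ S)
    (R : ℕ → ℝ)
    (hR : ∀ m, R m = Z d p (I.card + m) h x ^ (I.card + m) -
      ∑ t ∈ Finset.range m, (m.choose t : ℝ) * Z d p (I.card + m) h x ^ (m - t) * R t) :
    closureProb p x D v I S = R (S.card - I.card) := by
  classical
  refine eq_of_closure_recursion (fun k => Z d p k h x) R I _ hR (fun S hS => ?_) S hI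
  have h1 : ∀ j ∈ S, ∫ ξ, stayWeight x S (childData ξ D v j) ∂stackLaw d p = Z d p S.card h x :=
    fun j hj => by rw [integral_stayWeight hd hp0 hp1 x D v hj, hh]; rfl
  have h2 := prod_integral_stayWeight (p := p) x D v hS
  rw [Finset.prod_congr rfl h1, Finset.prod_const] at h2
  rw [h2]
  refine Finset.sum_congr rfl fun S' hS' => ?_
  rw [Finset.prod_congr rfl fun j hj => h1 j (Finset.mem_sdiff.1 hj).1, Finset.prod_const,
    Finset.card_sdiff_of_subset (Finset.mem_Icc.1 hS').2]

/-- Only sets that contain `I` contribute, and there are (d - |I|).choose m of them of size |I| + m.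
-/
theorem sum_closureProb (hd : 2 ≤ d) (hp0 : 0 ≤ p) (hp1 : p ≤ 1) {D : ℕ} {h : ℝ → ℝ}
    (hh : IsReturnGen d p D h) (x : ℝ) (v : Vertex d) (I : Finset (Fin d))
    (R : ℕ → ℝ)
    (hR : ∀ m, R m = Z d p (I.card + m) h x ^ (I.card + m) -
      ∑ t ∈ Finset.range m, (m.choose t : ℝ) * Z d p (I.card + m) h x ^ (m - t) * R t) :
    ∑ S, closureProb p x D v I S =
      ∑ m ∈ Finset.range (d - I.card + 1), ((d - I.card).choose m : ℝ) * R m := by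
  classical
  have h1 := sum_Icc_card (fun l => R (l - I.card)) (Finset.subset_univ I)
  simp only [Finset.card_univ, Fintype.card_fin, Nat.add_sub_cancel_left, nsmul_eq_mul] at h1
  rw [← h1, ← Finset.sum_subset (Finset.subset_univ (Finset.Icc I Finset.univ))]
  · refine Finset.sum_congr rfl fun S hS => ?_
    exact closureProb_eq hd hp0 hp1 hh x v (Finset.mem_Icc.1 hS).1 R hR
  · intro S _ hS
    have hIS : ¬ I ⊆ S := fun h => hS (Finset.mem_Icc.2 ⟨h, Finset.subset_univ S⟩)
    simp [closureProb, closureWeight_eq_zero x hIS]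

theorem sum_closureProb_one (hd : 2 ≤ d) (hp0 : 0 ≤ p) (hp1 : p ≤ 1) {D : ℕ} {h : ℝ → ℝ}
    (hh : IsReturnGen d p D h) (x : ℝ) (v : Vertex d) {I : Finset (Fin d)} (hI : I.card = 1) :
    ∑ S, closureProb p x D v I S = ∑ k ∈ Finset.Icc 1 d,
      ((d - 1).choose (k - 1) : ℝ) * MvPolynomial.eval (fun i => Z d p i h x) (P k) := by
  rw [sum_closureProb hd hp0 hp1 hh x v I
    (fun m => MvPolynomial.eval (fun i => Z d p i h x) (P (m + 1)))
    fun m => by rw [hI]; exact eval_P_succ _ m, sum_Icc_eq_sum_range, hI]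
  refine Finset.sum_congr (by congr 1; omega) fun m _ => ?_
  rw [Nat.add_sub_cancel_left, add_comm m]

theorem sum_closureProb_two (hd : 2 ≤ d) (hp0 : 0 ≤ p) (hp1 : p ≤ 1) {D : ℕ} {h : ℝ → ℝ}
    (hh : IsReturnGen d p D h) (x : ℝ) (v : Vertex d) {I : Finset (Fin d)} (hI : I.card = 2) :
    ∑ S, closureProb p x D v I S = ∑ k ∈ Finset.Icc 2 d,
      ((d - 2).choose (k - 2) : ℝ) * MvPolynomial.eval (fun i => Z d p i h x) (Q k) := by
  rw [sum_closureProb hd hp0 hp1 hh x v I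
    (fun m => MvPolynomial.eval (fun i => Z d p i h x) (Q (m + 2)))
    fun m => by rw [hI]; exact eval_Q_succ _ m, sum_Icc_eq_sum_range, hI]
  refine Finset.sum_congr (by congr 1; omega) fun m _ => ?_
  rw [Nat.add_sub_cancel_left, add_comm m]

/-- The contribution of a frog's first step to the generating function. -/
def upWeight (x : ℝ) : Move d → ℝ
  | .up => x
  | .down _ => 1

theorem pow_returns_succ (x : ℝ) (ξ : Stack d) (D : ℕ) (v : Vertex d) :
    x ^ returns ξ (D + 1) v =
      upWeight x (ξ ((v, .origin), 0)) * (upWeight x (ξ ((v, .fromParent), 0)) *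
        ∑ S, closureWeight x (startFinset (ξ ((v, .origin), 0)) (ξ ((v, .fromParent), 0))) S
          (childData ξ D v)) := by
  rw [returns_succ, pow_add, pow_add, ← Finset.prod_pow_eq_pow_sum, sum_closureWeight, mul_assoc]
  have h : ∀ m : Move d, x ^ (if m = .up then 1 else 0) = upWeight x m := by
    rintro (_ | i) <;> simp [upWeight]
  rw [h, h]

/-- The first two instructions at `v` lie outside the regions of all children, so they are
independent of the children's data and can be averaged last. -/
theorem integral_pow_returns_succ (x : ℝ) (D : ℕ) (v : Vertex d) :
    ∫ ξ, x ^ returns ξ (D + 1) v ∂stackLaw d p =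
      ∫ a, ∫ b, upWeight x a * (upWeight x b * ∑ S, closureProb p x D v (startFinset a b) S)
        ∂stepLaw d p .fromParent ∂stepLaw d p .origin := by
  have hcyl : ∀ a b : Move d, IsCylinder (fun ξ => upWeight x a * (upWeight x b *
      ∑ S, closureWeight x (startFinset a b) S (childData ξ D v))) (⋃ j, childRegion v j) := by
    intro a b
    have := isCylinder_finset_sum (s := Finset.univ) fun S _ =>
      (isCylinder_closureWeight x D v (startFinset a b) S).mono
        (Set.iUnion₂_subset fun j _ => Set.subset_iUnion (childRegion v) j)
    exact this.comp fun r => upWeight x a * (upWeight x b * r)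
  have hnot : ∀ l k, (∀ j, l ≠ .fromChild j) → ((v, l), k) ∉ ⋃ j, childRegion v j := by
    intro l k hl h
    obtain ⟨j, hj | hj⟩ := Set.mem_iUnion.1 h
    · exact not_suffix_cons hj
    · exact hl j (congrArg Prod.snd (show (v, l) = _ from hj))
  simp only [pow_returns_succ]
  have h1 : ∀ a : Move d, IsCylinder (fun ξ : Stack d =>
      upWeight x a * (upWeight x (ξ ((v, .fromParent), 0)) *
        ∑ S, closureWeight x (startFinset a (ξ ((v, .fromParent), 0))) S (childData ξ D v)))
      ({((v, .fromParent), 0)} ∪ ⋃ j, childRegion v j) := fun a =>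
    IsCylinder.bind (a := fun ξ => ξ ((v, .fromParent), 0)) (f := fun b ξ =>
      upWeight x a * (upWeight x b * ∑ S, closureWeight x (startFinset a b) S (childData ξ D v)))
      (isCylinder_eval (by simp)) fun ξ => (hcyl a _).mono Set.subset_union_right
  refine (integral_eval_bind _ h1 ?_).trans ?_
  · rintro (h | h)
    · simp at h
    · exact hnot _ _ (by simp) h
  · refine integral_congr_ae (.of_forall fun a => ?_)
    refine (integral_eval_bind _ (hcyl a) (hnot _ _ (by simp))).trans ?_
    refine integral_congr_ae (.of_forall fun b => ?_)
    have hlaw : IsProbabilityMeasure (stackLaw d p) := by unfold stackLaw; infer_instance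
    have := integral_finsetSum (μ := stackLaw d p) Finset.univ fun S _ =>
      (isCylinder_closureWeight x D v (startFinset a b) S).integrable (stackLaw d p)
    simp only [closureProb, ← this]
    exact (integral_const_mul _ _).trans (congrArg _ (integral_const_mul _ _))

/-- The admitted frog picks a uniform child. The woken frog goes up, with weight px, or picks the
same child, with probability (1 - p)/d; in both cases the closure starts from one child, giving the
`P` sum. It picks a different child with probability (d - 1)(1 - p)/d, giving the `Q` sum. -/
theorem isReturnGen_succ (hd : 2 ≤ d) (hp0 : 0 ≤ p) (hp1 : p ≤ 1) {D : ℕ} {h : ℝ → ℝ}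
    (hh : IsReturnGen d p D h) : IsReturnGen d p (D + 1) (A d p h) := by
  classical
  intro v x
  rw [integral_pow_returns_succ, A]
  set A₁ := ∑ k ∈ Finset.Icc 1 d,
    ((d - 1).choose (k - 1) : ℝ) * MvPolynomial.eval (fun i => Z d p i h x) (P k) with hA₁
  set A₂ := ∑ k ∈ Finset.Icc 2 d,
    ((d - 2).choose (k - 2) : ℝ) * MvPolynomial.eval (fun i => Z d p i h x) (Q k) with hA₂
  have h1 : ∀ i : Fin d, ∑ S, closureProb p x D v (startFinset .up (.down i)) S = A₁ := fun i =>
    sum_closureProb_one hd hp0 hp1 hh x v (by simp [startFinset, Finset.filter_eq])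
  have h2 : ∀ i i' : Fin d, ∑ S, closureProb p x D v (startFinset (.down i') (.down i)) S =
      A₂ + if i' = i then A₁ - A₂ else 0 := by
    intro i i'
    by_cases hi : i' = i
    · rw [if_pos hi, add_sub_cancel]
      exact sum_closureProb_one hd hp0 hp1 hh x v (by simp [startFinset, Finset.filter_eq, hi])
    · rw [if_neg hi, add_zero]
      refine sum_closureProb_two hd hp0 hp1 hh x v ?_
      simp only [startFinset, Move.down.injEq, Finset.filter_or, Finset.filter_eq,
        Finset.mem_univ, if_true]
      rw [Finset.card_union_of_disjoint (by simpa using hi)]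
      simp
  simp only [integral_stepLaw hd hp0 hp1, sum_move, h1, h2, stepProb, upWeight, zero_mul, zero_add,
    one_mul, Finset.sum_const, Finset.card_univ, Fintype.card_fin, nsmul_eq_mul, ← Finset.mul_sum,
    Finset.sum_add_distrib, Finset.sum_ite_eq, Finset.mem_univ, if_true]
  have hd0 : (d : ℝ) ≠ 0 := by positivity
  field_simp
  ring

theorem isReturnGen_iterate (hd : 2 ≤ d) (hp0 : 0 ≤ p) (hp1 : p ≤ 1) (D : ℕ) :
    IsReturnGen d p D ((A d p)^[D] fun _ => 1) := by
  have hlaw : IsProbabilityMeasure (stackLaw d p) := by unfold stackLaw; infer_instance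
  induction D with
  | zero => exact fun v x => by simp [returns]
  | succ D ih =>
    rw [Function.iterate_succ_apply']
    exact isReturnGen_succ hd hp0 hp1 ih

/-- The initial frog enters one uniform child, and every later visit to the root is a return from
that child; all children have the same generating function. -/
theorem integral_pow_rootReturns (hd : 2 ≤ d) (hp0 : 0 ≤ p) (hp1 : p ≤ 1) {D : ℕ} {h : ℝ → ℝ}
    (hh : IsReturnGen d p D h) (x : ℝ) :
    ∫ ξ, x ^ rootReturns ξ D ∂stackLaw d p = h x := by
  classical
  let f : Move d → Stack d → ℝ := fun m ξ => match m with
    | .up => x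
    | .down j => x ^ returns ξ D [j]
  have h1 : ∀ ξ : Stack d, x ^ rootReturns ξ D = f (ξ (([], .fromParent), 0)) ξ := by
    intro ξ
    rcases hm : ξ (([], .fromParent), 0) with _ | j <;>
      simp [f, rootReturns, instrCount, Nat.count_succ, hm]
  simp only [h1]
  have hd0 : (d : ℝ) ≠ 0 := by positivity
  refine (integral_eval_bind (fun q : Place d × ℕ => stepLaw d p q.1.2)
    (f := f) (T := ⋃ j : Fin d, below [j]) ?_ ?_).trans ?_
  · rintro (_ | j)
    · exact isCylinder_const _ _
    · exact ((isCylinder_returns D [j]).comp fun n => x ^ n).mono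
        (Set.subset_iUnion (fun j : Fin d => below [j]) j)
  · intro h
    obtain ⟨j, hj⟩ := Set.mem_iUnion.1 h
    exact not_suffix_cons hj
  · rw [integral_stepLaw hd hp0 hp1, sum_move]
    have h2 : ∀ j : Fin d, ∫ ξ, x ^ returns ξ D [j] ∂(Measure.infinitePi
        fun q : Place d × ℕ => stepLaw d p q.1.2) = h x := fun j => hh [j] x
    simp only [f, h2, stepProb]
    simp
    field_simp

end

end

section

open Filter Topology

variable {d : ℕ} {p : ℝ}

/-! ### The total number of visits as a limit -/

theorem encard_visits (rank : Vertex d → ℕ) (ω : Env d) (n : ℕ) :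
    {q : ℕ × Vertex d | q.1 < n ∧ Attempts ω (config rank ω q.1) q.2 []}.encard =
      visitsUpTo rank ω n := by
  induction n with
  | zero => simp [visitsUpTo]
  | succ n ih =>
    have h : {q : ℕ × Vertex d | q.1 < n + 1 ∧ Attempts ω (config rank ω q.1) q.2 []} =
        {q : ℕ × Vertex d | q.1 < n ∧ Attempts ω (config rank ω q.1) q.2 []} ∪
          Prod.mk n '' jumpers ω (config rank ω n) := by
      ext ⟨k, u⟩
      simp only [Set.mem_ofPred_eq, Set.mem_union, Set.mem_image, Prod.mk.injEq,
        Order.lt_add_one_iff, le_iff_lt_or_eq]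
      constructor
      · rintro ⟨hk | rfl, hu⟩
        · exact .inl ⟨hk, hu⟩
        · exact .inr ⟨u, hu, rfl, rfl⟩
      · rintro (⟨hk, hu⟩ | ⟨u, hu, rfl, rfl⟩)
        · exact ⟨.inl hk, hu⟩
        · exact ⟨.inr rfl, hu⟩
    have hdis : Disjoint {q : ℕ × Vertex d | q.1 < n ∧ Attempts ω (config rank ω q.1) q.2 []}
        (Prod.mk n '' jumpers ω (config rank ω n)) := by
      rw [Set.disjoint_left]
      rintro _ hq ⟨u, -, rfl⟩
      exact lt_irrefl _ hq.1
    have hfin : (jumpers ω (config rank ω n)).Finite :=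
      (finite_actives_config rank ω n).subset fun u hu => hu.mem_actives
    rw [h, Set.encard_union_eq hdis, ih, (Prod.mk_right_injective n).encard_image, visitsUpTo,
      visitsUpTo, Finset.sum_range_succ, Nat.cast_add, hfin.cast_ncard_eq]

theorem rootVisits_eq_iSup (rank : Vertex d → ℕ) (ω : Env d) :
    rootVisits rank ω = ⨆ n, (visitsUpTo rank ω n : ℕ∞) := by
  set S := {q : ℕ × Vertex d | Attempts ω (config rank ω q.1) q.2 []} with hS
  have hfin : ∀ T : Set (ℕ × Vertex d), T.Finite → T ⊆ S →
      T.encard ≤ ⨆ n, (visitsUpTo rank ω n : ℕ∞) := by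
    intro T hT hTS
    obtain ⟨N, hN⟩ := (hT.image Prod.fst).bddAbove
    refine le_trans ?_ (le_iSup _ (N + 1))
    rw [← encard_visits]
    exact Set.encard_le_encard fun q hq =>
      ⟨Nat.lt_succ_of_le (hN ⟨q, hq, rfl⟩), hTS hq⟩
  refine le_antisymm ?_ (iSup_le fun n => ?_)
  · rcases S.finite_or_infinite with h | h
    · exact hfin S h subset_rfl
    -- An infinite set of jumps has finite subsets of every size, so the supremum exceeds every
    -- natural number.
    · refine le_of_le_of_eq le_top (ENat.eq_top_iff_forall_ge.2 fun k => ?_).symm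
      obtain ⟨T, hTS, hT⟩ := h.exists_subset_card_eq k
      refine le_trans ?_ (hfin T T.finite_toSet hTS)
      rw [Set.encard_coe_eq_coe_finsetCard, hT]
  · rw [← encard_visits]
    exact Set.encard_le_encard fun q hq => hq.2

theorem measurable_iSup_natCast {Ω : Type*} [MeasurableSpace Ω] {u : ℕ → Ω → ℕ}
    (hu : ∀ n, Measurable (u n)) : Measurable fun ω => ⨆ n, (u n ω : ℕ∞) := by
  have : BorelSpace ℕ∞ := ⟨borel_eq_top_of_countable.symm⟩
  exact Measurable.iSup fun n => (measurable_from_top (f := fun n : ℕ => (n : ℕ∞))).comp (hu n)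

theorem measurable_rootVisits (rank : Vertex d → ℕ) : Measurable (rootVisits rank) := by
  have h : rootVisits rank = fun ω => ⨆ n, (visitsUpTo rank ω n : ℕ∞) :=
    funext fun ω => rootVisits_eq_iSup rank ω
  rw [h]
  exact measurable_iSup_natCast (measurable_visitsUpTo rank)

theorem visitsUpTo_mono (rank : Vertex d → ℕ) (ω : Env d) : Monotone (visitsUpTo rank ω) :=
  fun _ _ h => Finset.sum_le_sum_of_subset (Finset.range_mono h)

/-- The convention x ^ ∞ = 0 is the limit of the powers precisely because x < 1; at x = 1 it fails
for unbounded sequences. -/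
theorem tendsto_pow_powENat {u : ℕ → ℕ} (hu : Monotone u) {x : ℝ} (hx0 : 0 ≤ x) (hx1 : x < 1) :
    Tendsto (fun n => x ^ u n) atTop (𝓝 (powENat x (⨆ n, (u n : ℕ∞)))) := by
  by_cases h : BddAbove (Set.range u)
  · rw [← ENat.natCast_iSup h]
    refine tendsto_const_nhds.congr' ?_
    have := tendsto_atTop_ciSup hu h
    rw [nhds_discrete, tendsto_pure] at this
    filter_upwards [this] with n hn
    rw [hn]
    rfl
  · rw [ENat.iSup_natCast_eq_top.2 h]
    exact (tendsto_pow_atTop_nhds_zero_of_lt_one hx0 hx1).comp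
      (tendsto_atTop_atTop_of_monotone' hu h)

theorem powENat_nonneg {x : ℝ} (hx0 : 0 ≤ x) (n : ℕ∞) : 0 ≤ powENat x n := by
  induction n using ENat.recTopCoe with
  | top => exact le_rfl
  | coe n => exact pow_nonneg hx0 n

theorem powENat_le_one {x : ℝ} (hx0 : 0 ≤ x) (hx1 : x ≤ 1) (n : ℕ∞) : powENat x n ≤ 1 := by
  induction n using ENat.recTopCoe with
  | top => exact zero_le_one
  | coe n => exact pow_le_one₀ hx0 hx1

theorem powENat_mono {x y : ℝ} (hx0 : 0 ≤ x) (hxy : x ≤ y) (n : ℕ∞) :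
    powENat x n ≤ powENat y n := by
  induction n using ENat.recTopCoe with
  | top => exact le_rfl
  | coe n => exact pow_le_pow_left₀ hx0 hxy n

theorem measurable_powENat (x : ℝ) : Measurable (powENat x) := measurable_of_countable _

theorem integrable_powENat {Ω : Type*} [MeasurableSpace Ω] {ν : Measure Ω} [IsFiniteMeasure ν]
    {V : Ω → ℕ∞} (hV : Measurable V) {x : ℝ} (hx0 : 0 ≤ x) (hx1 : x ≤ 1) :
    Integrable (fun ω => powENat x (V ω)) ν :=
  Integrable.of_bound ((measurable_powENat x).comp hV).aestronglyMeasurable 1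
    (.of_forall fun ω => by
      rw [Real.norm_of_nonneg (powENat_nonneg hx0 _)]
      exact powENat_le_one hx0 hx1 _)

theorem tendsto_integral_pow {Ω : Type*} [MeasurableSpace Ω] {ν : Measure Ω} [IsFiniteMeasure ν]
    {u : ℕ → Ω → ℕ} (hu : ∀ n, Measurable (u n)) (hmono : ∀ ω, Monotone fun n => u n ω)
    {x : ℝ} (hx0 : 0 ≤ x) (hx1 : x < 1) :
    Tendsto (fun n => ∫ ω, x ^ u n ω ∂ν) atTop
      (𝓝 (∫ ω, powENat x (⨆ n, (u n ω : ℕ∞)) ∂ν)) := by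
  refine tendsto_integral_of_dominated_convergence (fun _ => 1)
    (fun n => ((measurable_from_top (f := fun k : ℕ => x ^ k)).comp (hu n)).aestronglyMeasurable)
    (integrable_const _) (fun n => .of_forall fun ω => ?_)
    (.of_forall fun ω => tendsto_pow_powENat (hmono ω) hx0 hx1)
  rw [Real.norm_of_nonneg (pow_nonneg hx0 _)]
  exact pow_le_one₀ hx0 hx1.le

/-! ### Continuity of the operator -/

/-- Convergence is available for the variables z_1, …, z_k only, so the limit is taken along the
recursion, which involves no others. -/
theorem tendsto_eval_P {z : ℕ → ℕ → ℝ} {z' : ℕ → ℝ} (k : ℕ) (hk : 1 ≤ k)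
    (h : ∀ i, 1 ≤ i → i ≤ k → Tendsto (fun n => z n i) atTop (𝓝 (z' i))) :
    Tendsto (fun n => MvPolynomial.eval (z n) (P k)) atTop (𝓝 (MvPolynomial.eval z' (P k))) := by
  induction k using Nat.strong_induction_on with
  | _ k ih =>
    obtain ⟨m, rfl⟩ := Nat.exists_eq_add_of_le' hk
    rw [eval_P_succ, funext fun n => eval_P_succ (z n) m]
    have hz := h (1 + m) (by omega) (by omega)
    refine (hz.pow _).sub (tendsto_finsetSum _ fun t ht => ?_)
    have ht := Finset.mem_range.1 ht
    exact ((hz.pow _).const_mul _).mul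
      (ih (t + 1) (by omega) (by omega) fun i h1 h2 => h i h1 (by omega))

theorem tendsto_eval_Q {z : ℕ → ℕ → ℝ} {z' : ℕ → ℝ} (k : ℕ) (hk : 2 ≤ k)
    (h : ∀ i, 1 ≤ i → i ≤ k → Tendsto (fun n => z n i) atTop (𝓝 (z' i))) :
    Tendsto (fun n => MvPolynomial.eval (z n) (Q k)) atTop (𝓝 (MvPolynomial.eval z' (Q k))) := by
  induction k using Nat.strong_induction_on with
  | _ k ih =>
    obtain ⟨m, rfl⟩ := Nat.exists_eq_add_of_le' hk
    rw [eval_Q_succ, funext fun n => eval_Q_succ (z n) m]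
    have hz := h (2 + m) (by omega) (by omega)
    refine (hz.pow _).sub (tendsto_finsetSum _ fun t ht => ?_)
    have ht := Finset.mem_range.1 ht
    exact ((hz.pow _).const_mul _).mul
      (ih (t + 2) (by omega) (by omega) fun i h1 h2 => h i h1 (by omega))

theorem tendsto_A {h : ℕ → ℝ → ℝ} {h' : ℝ → ℝ} {x : ℝ}
    (hh : ∀ k, k < d → Tendsto (fun n => h n (c d p k x)) atTop (𝓝 (h' (c d p k x)))) :
    Tendsto (fun n => A d p (h n) x) atTop (𝓝 (A d p h' x)) := by
  have hz : ∀ i, 1 ≤ i → i ≤ d →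
      Tendsto (fun n => Z d p i (h n) x) atTop (𝓝 (Z d p i h' x)) :=
    fun i h1 h2 => hh (i - 1) (by omega)
  unfold A
  refine ((tendsto_finsetSum _ fun k hk => (tendsto_eval_P k (Finset.mem_Icc.1 hk).1
    fun i h1 h2 => hz i h1 (h2.trans (Finset.mem_Icc.1 hk).2)).const_mul _).const_mul _).add
    ((tendsto_finsetSum _ fun k hk => (tendsto_eval_Q k (Finset.mem_Icc.1 hk).1
    fun i h1 h2 => hz i h1 (h2.trans (Finset.mem_Icc.1 hk).2)).const_mul _).const_mul _)

theorem denominator_pos (hd : 2 ≤ d) (hp0 : 0 ≤ p) :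
    0 < p + (1 - p) * (d - 1) / d := by
  have hd' : (2 : ℝ) ≤ d := by exact_mod_cast hd
  have h : p + (1 - p) * (d - 1) / d = ((d - 1) + p) / d := by
    field_simp
    ring
  rw [h]
  exact div_pos (by linarith) (by linarith)

theorem c_nonneg (hd : 2 ≤ d) (hp0 : 0 ≤ p) (hp1 : p ≤ 1) (k : ℕ) {x : ℝ} (hx : 0 ≤ x) :
    0 ≤ c d p k x := by
  have hq : 0 ≤ 1 - p := by linarith
  exact div_nonneg (by positivity) (denominator_pos hd hp0).le

theorem c_le (hd : 2 ≤ d) (hp0 : 0 ≤ p) (hp1 : p ≤ 1) {k : ℕ} (hk : k < d) (x : ℝ) :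
    c d p k x ≤ (p * x + (1 - p) * (d - 1) / d) / (p + (1 - p) * (d - 1) / d) := by
  have hq : 0 ≤ 1 - p := by linarith
  have hk' : (k : ℝ) ≤ d - 1 := by
    have : (k : ℝ) + 1 ≤ d := by exact_mod_cast hk
    linarith
  have := (denominator_pos hd hp0).le
  unfold c
  gcongr

/-- The extreme case is k = d - 1, where c is a weighted average of x and 1 in which x has positive
weight since p > 0. -/
theorem c_lt_one (hd : 2 ≤ d) (hp0 : 0 < p) (hp1 : p ≤ 1) {k : ℕ} (hk : k < d) {x : ℝ}
    (hx : x < 1) : c d p k x < 1 := by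
  refine (c_le hd hp0.le hp1 hk x).trans_lt ?_
  rw [div_lt_one (denominator_pos hd hp0.le)]
  nlinarith

theorem c_le_one (hd : 2 ≤ d) (hp0 : 0 ≤ p) (hp1 : p ≤ 1) {k : ℕ} (hk : k < d) {x : ℝ}
    (hx : x ≤ 1) : c d p k x ≤ 1 := by
  refine (c_le hd hp0 hp1 hk x).trans ?_
  rw [div_le_one (denominator_pos hd hp0)]
  nlinarith

/-! ### The generating function -/

theorem isCylinder_rootReturns (D : ℕ) :
    IsCylinder (fun ξ : Stack d => rootReturns ξ D) Set.univ := by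
  classical
  have h1 := (isCylinder_instrCount (([], .fromParent) : Place d) .up 1).mono (Set.subset_univ _)
  have h2 : IsCylinder (fun (ξ : Stack d) (j : Fin d) => returns ξ D [j]) Set.univ :=
    isCylinder_pi fun j => (isCylinder_returns D [j]).mono (Set.subset_univ _)
  have h3 := isCylinder_eval (α := Move d) (Set.mem_univ ((([], .fromParent) : Place d), 0))
  have := (h1.prodMk (h2.prodMk h3)).comp fun z =>
    z.1 + ∑ j, if z.2.2 = .down j then z.2.1 j else 0
  convert this using 3
  rw [rootReturns]

theorem measurable_rootExits {rank : Vertex d → ℕ} (hrank : Function.Injective rank) (n : ℕ) :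
    Measurable fun ξ : Stack d => rootExits ξ (odometer ξ n) := by
  have h := isCylinder_explore (read := readStack rank) (next := nextPlain rank)
    (good := fun s => (actives s.1.1).Finite) (act := fun s => activeFinset s.1.1)
    (rem := fun _ => Set.univ) (fun s m h => finite_actives_step h)
    (fun s h m m' hm => by rw [nextPlain, nextState_dependsOn h hm, nextPlain])
    (fun _ _ _ _ => Set.mem_univ _)
    (fun _ _ _ => Set.subset_univ _) n (initialState d, 0) finite_actives_initial
  have h' := (h.comp fun s => s.1.2).measurable
  have heq : ∀ ξ : Stack d, ((explore (readStack rank) (nextPlain rank) ξ)^[n]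
      (initialState d, 0)).1.2 = rootExits ξ (odometer ξ n) := stackState_visits hrank (n := n)
  simpa only [heq] using h'

section

variable {rank : Vertex d → ℕ}

theorem isProbabilityMeasure_envLaw [∀ l, IsProbabilityMeasure (stepLaw d p l)] :
    IsProbabilityMeasure (envLaw d p) := by
  unfold envLaw
  infer_instance

theorem isProbabilityMeasure_stackLaw [∀ l, IsProbabilityMeasure (stepLaw d p l)] :
    IsProbabilityMeasure (stackLaw d p) := by
  unfold stackLaw
  infer_instance

theorem genFun_mem_Icc (hd : 2 ≤ d) (hp0 : 0 ≤ p) (hp1 : p ≤ 1) {x : ℝ} (hx0 : 0 ≤ x)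
    (hx1 : x ≤ 1) : genFun d p rank x ∈ Set.Icc (0 : ℝ) 1 := by
  have := fun l => isProbabilityMeasure_stepLaw hd hp0 hp1 l
  have := isProbabilityMeasure_envLaw (d := d) (p := p)
  refine ⟨integral_nonneg fun ω => powENat_nonneg hx0 _, ?_⟩
  refine (integral_mono (integrable_powENat (measurable_rootVisits rank) hx0 hx1)
    (integrable_const 1) fun ω => powENat_le_one hx0 hx1 _).trans ?_
  simp

theorem genFun_le_genFun (hd : 2 ≤ d) (hp0 : 0 ≤ p) (hp1 : p ≤ 1) {x y : ℝ} (hx0 : 0 ≤ x)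
    (hxy : x ≤ y) (hy1 : y ≤ 1) : genFun d p rank x ≤ genFun d p rank y := by
  have := fun l => isProbabilityMeasure_stepLaw hd hp0 hp1 l
  have := isProbabilityMeasure_envLaw (d := d) (p := p)
  exact integral_mono (integrable_powENat (measurable_rootVisits rank) hx0 (hxy.trans hy1))
    (integrable_powENat (measurable_rootVisits rank) (hx0.trans hxy) hy1)
    fun ω => powENat_mono hx0 hxy _

/-- The generating function is the limit of the iterates of the operator. -/
theorem tendsto_iterate_A (hd : 2 ≤ d) (hp0 : 0 ≤ p) (hp1 : p ≤ 1)
    (hrank : Function.Injective rank) {x : ℝ} (hx0 : 0 ≤ x) (hx1 : x < 1) :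
    Tendsto (fun D => (A d p)^[D] (fun _ => 1) x) atTop (𝓝 (genFun d p rank x)) := by
  have := fun l => isProbabilityMeasure_stepLaw hd hp0 hp1 l
  have := isProbabilityMeasure_envLaw (d := d) (p := p)
  have := isProbabilityMeasure_stackLaw (d := d) (p := p)
  have hiter : ∀ D, (A d p)^[D] (fun _ => 1) x = ∫ ξ, x ^ rootReturns ξ D ∂stackLaw d p :=
    fun D => (integral_pow_rootReturns hd hp0 hp1 (isReturnGen_iterate hd hp0 hp1 D) x).symm
  have hint : ∀ D, Integrable (fun ξ => x ^ rootReturns ξ D) (stackLaw d p) := fun D =>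
    ((isCylinder_rootReturns D).comp fun n => x ^ n).integrable _
  have hlim : Tendsto (fun n => ∫ ω, x ^ visitsUpTo rank ω n ∂envLaw d p) atTop
      (𝓝 (genFun d p rank x)) := by
    have h := tendsto_integral_pow (ν := envLaw d p) (measurable_visitsUpTo rank)
      (visitsUpTo_mono rank) hx0 hx1
    simpa only [genFun, rootVisits_eq_iSup] using h
  have hstack : ∀ n, ∫ ω, x ^ visitsUpTo rank ω n ∂envLaw d p =
      ∫ ξ, x ^ rootExits ξ (odometer ξ n) ∂stackLaw d p := by
    intro n
    rw [integral_visitsUpTo hrank ⟨0, by omega⟩ p (fun k => x ^ k) n]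
    simp only [stackState_visits hrank, odometer]
  have hlim' := tendsto_integral_pow (ν := stackLaw d p) (measurable_rootExits hrank)
    rootExits_mono hx0 hx1
  simp only [hstack] at hlim
  -- At each time the two models have the same generating function, hence so do the total counts.
  have hgen := tendsto_nhds_unique hlim hlim'
  -- Squeeze: the truncated count at depth D is at most the total count and at least the count up to
  -- time D, and x ^ n decreases in n.
  refine tendsto_of_tendsto_of_tendsto_of_le_of_le tendsto_const_nhds hlim (fun D => ?_)
    fun D => ?_
  · dsimp only
    rw [hgen, hiter]
    refine integral_mono (integrable_powENat ?_ hx0 hx1.le) (hint D) fun ξ => ?_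
    · exact measurable_iSup_natCast (measurable_rootExits hrank)
    · refine le_of_tendsto (tendsto_pow_powENat (rootExits_mono ξ) hx0 hx1) ?_
      exact (eventually_rootReturns_le ξ D).mono fun n hn =>
        pow_le_pow_of_le_one hx0 hx1.le hn
  · dsimp only
    rw [hiter]
    refine integral_mono (hint D) ?_ fun ξ =>
      pow_le_pow_of_le_one hx0 hx1.le (rootExits_le_rootReturns le_rfl)
    refine Integrable.of_bound ((measurable_from_top (f := fun k : ℕ => x ^ k)).comp
      (measurable_rootExits hrank D)).aestronglyMeasurable 1 (.of_forall fun ξ => ?_)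
    rw [Real.norm_of_nonneg (pow_nonneg hx0 _)]
    exact pow_le_one₀ hx0 hx1.le

/-- The truncated numbers of returns are finite, so no mass is lost at x = 1, in contrast to
`genFun`. -/
theorem iterate_A_one (hd : 2 ≤ d) (hp0 : 0 ≤ p) (hp1 : p ≤ 1) (D : ℕ) :
    (A d p)^[D] (fun _ => 1) 1 = 1 := by
  have := fun l => isProbabilityMeasure_stepLaw hd hp0 hp1 l
  have := isProbabilityMeasure_stackLaw (d := d) (p := p)
  rw [← isReturnGen_iterate hd hp0 hp1 D []]
  simp

/-- Without steps up from the starting vertices, no frog ever jumps to the root. -/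
theorem genFun_one_of_eq_zero (hd : 2 ≤ d) (hrank : Function.Injective rank) :
    genFun d 0 rank 1 = 1 := by
  -- For p = 0 the variable x drops out of every c^{(k)} and of the prefactor. The iterates at 0
  -- therefore equal those at 1, which are 1, and monotonicity carries g(0) = 1 over to g(1).
  have hA : ∀ (h : ℝ → ℝ) x y, A d 0 h x = A d 0 h y := fun h x y => by
    simp [A, Z, c]
  have h0 : genFun d 0 rank 0 = 1 := by
    refine tendsto_nhds_unique ((tendsto_add_atTop_iff_nat 1).2
      (tendsto_iterate_A hd le_rfl zero_le_one hrank le_rfl zero_lt_one)) ?_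
    refine tendsto_const_nhds.congr fun D => ?_
    have h1 := iterate_A_one hd le_rfl zero_le_one (D + 1)
    rw [Function.iterate_succ_apply'] at h1 ⊢
    rw [hA _ 0 1, h1]
  refine le_antisymm (genFun_mem_Icc hd le_rfl zero_le_one zero_le_one le_rfl).2 ?_
  exact h0.ge.trans (genFun_le_genFun hd le_rfl zero_le_one le_rfl zero_le_one le_rfl)

theorem genFun_eq_A (hd : 2 ≤ d) (hp0 : 0 ≤ p) (hp1 : p ≤ 1) (hrank : Function.Injective rank)
    {x : ℝ} (hx0 : 0 ≤ x) (hx1 : x < 1) :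
    genFun d p rank x = A d p (genFun d p rank) x := by
  have h1 := (tendsto_add_atTop_iff_nat 1).2 (tendsto_iterate_A hd hp0 hp1 hrank hx0 hx1)
  simp only [Function.iterate_succ_apply'] at h1
  refine tendsto_nhds_unique h1 (tendsto_A fun k hk => ?_)
  -- Convergence of the iterates is known below 1. The argument 1 arises only for p = 0, where both
  -- the iterates and the limit take the value 1 there.
  rcases (c_le_one hd hp0 hp1 hk hx1.le).lt_or_eq with hc | hc
  · exact tendsto_iterate_A hd hp0 hp1 hrank (c_nonneg hd hp0 hp1 k hx0) hc
  · rcases hp0.eq_or_lt with rfl | hp0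
    · simp only [hc, iterate_A_one hd le_rfl hp1, genFun_one_of_eq_zero hd hrank]
      exact tendsto_const_nhds
    · exact absurd hc (c_lt_one hd hp0 hp1 hk hx1).ne

end

end

end FrogModel

end

theorem proposition3p1 (d : ℕ) (hd : 2 ≤ d) (p : ℝ) (hp0 : 0 ≤ p) (hp : p ≤ 1 / 2)
    (rank : FrogModel.Vertex d → ℕ) (hrank : Function.Injective rank) :
    Measurable (FrogModel.rootVisits rank) ∧
    Set.MapsTo (FrogModel.genFun d p rank) (Set.Ico 0 1) (Set.Icc 0 1) ∧
    MonotoneOn (FrogModel.genFun d p rank) (Set.Ico 0 1) ∧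
    ∀ x ∈ Set.Ico (0 : ℝ) 1,
      FrogModel.genFun d p rank x = FrogModel.A d p (FrogModel.genFun d p rank) x := by
  have hp1 : p ≤ 1 := by linarith
  exact ⟨FrogModel.measurable_rootVisits rank,
    fun x hx => FrogModel.genFun_mem_Icc hd hp0 hp1 hx.1 hx.2.le,
    fun x hx y hy hxy => FrogModel.genFun_le_genFun hd hp0 hp1 hx.1 hxy hy.2.le,
    fun x hx => FrogModel.genFun_eq_A hd hp0 hp1 hrank hx.1 hx.2⟩
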